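/- Let $\Bbbk$ be an algebraically closed field of characteristic zero; a variety is an integral scheme, separated and of finite type over $\Bbbk$. Let $\pi:C\to S$ be an affine cone of varieties, i.e. $\pi$ is an affine morphism of varieties together with a grading $\pi_*\mathcal O_C=\bigoplus_{n\ge 0}\mathcal A_n$ of the quasi-coherent $\mathcal O_S$-algebra $\pi_*\mathcal O_C$ with $\mathcal A_0=\mathcal O_S$; equivalently, $C$ carries a $\mathbb G_m$-action over $S$ for which $f(t.x)=t^nf(x)$ when $f\in\mathcal A_n$. Let $Z=\mathbb V(\bigoplus_{n>0}\mathcal A_n)\subseteq C$ be the zero section, so that $\pi|_Z:Z\to S$ is an isomorphism. Let $r,w\ge 1$ and let $\mathbb G_a^r$ act on $C$ such that $\pi$ is $\mathbb G_a^r$-invariant and the actions of $\mathbb G_a^r$ and $\mathbb G_m$ form an action of $\mathbb G_a^r\rtimes_w\mathbb G_m$, i.e. $t.(u.x)=(t^wu).(t.x)$. Let $\mathfrak u=\Bbbk^r$ be the Lie algebra of $\mathbb G_a^r$ and, for a $\Bbbk$-point $x$ of $C$, let $\mathrm{Stab}_{\mathfrak u}(x)\subseteq\mathfrak u$ be the Lie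 algebra of the stabiliser of $x$. Put $d(\pi)=\min_{z\in Z(\Bbbk)}\dim\mathrm{Stab}_{\mathfrak u}(z)$ and assume that $\dim\mathrm{Stab}_{\mathfrak u}(z)=d(\pi)$ for all $z\in Z(\Bbbk)$. Then the image of $\mathbb G_a^r\times Z\to C$, $(u,z)\mapsto u.z$, is closed. Moreover, every point of $S$ has an affine open neighbourhood $V$ for which there is a linear subspace $\mathfrak v\subseteq\mathfrak u$ with the following properties. Write $C_V=\pi^{-1}(V)$ and $Z_V=Z\cap C_V$, and let $U'\subseteq\mathbb G_a^r$ be the subgroup with Lie algebra $\mathfrak v$. 1. $\mathfrak u=\mathfrak v\oplus\mathrm{Stab}_{\mathfrak u}(z)$ for all $z\in Z_V(\Bbbk)$. 2. $U'$ acts freely on $C_V$, i.e. for every scheme $T$, an element of $U'(T)$ that fixes a point of $C_V(T)$ is trivial. 3. The images of $\mathbb G_a^r\times Z_V\to C_V$ and of $U'\times Z_V\to C_V$ are the same set, and this set is the underlying set of the scheme-theoretic image of $U'\times Z_V\to C_V$. 4. The scheme-theoretic images of $\mathbb G_a^r\times Z_V\to C_V$ and $U'\times Z_V\to C_V$ are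 the same closed subscheme of $C_V$. -/

import Mathlib

open CategoryTheory AlgebraicGeometry

universe u

noncomputable section

namespace GradedAdditive

/-! ### Morphisms into a scheme that is affine over the base -/

lemma affine_preimage {C S : Scheme.{u}} (π : C ⟶ S) [IsAffineHom π] (U : S.affineOpens) :
    IsAffineOpen (π ⁻¹ᵁ U.1) := IsAffineOpen.preimage (U := U.1) U.2 π

section Relative

variable {C S T : Scheme.{u}} (π : C ⟶ S) [IsAffineHom π] (q : T ⟶ S)
  (φ : ∀ U : S.affineOpens, Γ(C, π ⁻¹ᵁ U.1) ⟶ Γ(T, q ⁻¹ᵁ U.1))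

/-- The morphism `q⁻¹ U ⟶ C` induced by a ring homomorphism `Γ(C, π⁻¹ U) → Γ(T, q⁻¹ U)`. -/
def relPiece (U : S.affineOpens) : (q ⁻¹ᵁ U.1).toScheme ⟶ C :=
  (q ⁻¹ᵁ U.1).toSpecΓ ≫ Spec.map (φ U) ≫ (affine_preimage π U).fromSpec

/-- Compatibility of a family of ring homomorphisms with restriction. -/
def RelCompat : Prop := ∀ (U V : S.affineOpens) (h : U ≤ V),
  C.presheaf.map (homOfLE (π.preimage_mono h)).op ≫ φ U =
    φ V ≫ T.presheaf.map (homOfLE (q.preimage_mono h)).op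

variable {φ}

lemma homOfLE_relPiece (hφ : RelCompat π q φ) (U V : S.affineOpens) (h : U ≤ V) :
    T.homOfLE (q.preimage_mono h) ≫ relPiece π q φ V = relPiece π q φ U := by
  unfold relPiece
  rw [← Scheme.Opens.toSpecΓ_SpecMap_presheaf_map_assoc, ← Spec.map_comp_assoc, ← hφ U V h,
    Spec.map_comp_assoc, IsAffineOpen.map_fromSpec]

lemma exists_relHom (hφ : RelCompat π q φ) :
    ∃ f : T ⟶ C, ∀ U : S.affineOpens, (q ⁻¹ᵁ U.1).ι ≫ f = relPiece π q φ U := by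
  let 𝒰 : T.OpenCover := T.openCoverOfIsOpenCover (fun U : S.affineOpens ↦ q ⁻¹ᵁ U.1)
    (.comap (iSup_affineOpens_eq_top S) q.base.1)
  refine ⟨𝒰.glueMorphisms (relPiece π q φ) ?_, fun U ↦ 𝒰.ι_glueMorphisms _ _ U⟩
  intro (U : S.affineOpens) (V : S.affineOpens)
  change Limits.pullback.fst (q ⁻¹ᵁ U.1).ι (q ⁻¹ᵁ V.1).ι ≫ _ =
    Limits.pullback.snd (q ⁻¹ᵁ U.1).ι (q ⁻¹ᵁ V.1).ι ≫ _
  have hc := Limits.pullback.condition (f := (q ⁻¹ᵁ U.1).ι) (g := (q ⁻¹ᵁ V.1).ι)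
  generalize Limits.pullback.fst (q ⁻¹ᵁ U.1).ι (q ⁻¹ᵁ V.1).ι = a at *
  generalize Limits.pullback.snd (q ⁻¹ᵁ U.1).ι (q ⁻¹ᵁ V.1).ι = b at *
  refine Scheme.hom_ext_of_forall _ _ fun x ↦ ?_
  have hx : q ((a ≫ (q ⁻¹ᵁ U.1).ι) x) ∈ U.1 ⊓ V.1 :=
    ⟨(a x).2, by rw [hc]; exact (b x).2⟩
  obtain ⟨_, ⟨W, hW, rfl⟩, hxW, hle⟩ := S.isBasis_affineOpens.exists_subset_of_mem_open hx
    (U.1 ⊓ V.1).2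
  have hWU : (⟨W, hW⟩ : S.affineOpens) ≤ U := fun y hy ↦ (hle hy).1
  have hWV : (⟨W, hW⟩ : S.affineOpens) ≤ V := fun y hy ↦ (hle hy).2
  refine ⟨(a ≫ (q ⁻¹ᵁ U.1).ι) ⁻¹ᵁ (q ⁻¹ᵁ W), hxW, ?_⟩
  set g := a ≫ (q ⁻¹ᵁ U.1).ι with hg
  set O := g ⁻¹ᵁ (q ⁻¹ᵁ W)
  have h1 : O.ι ≫ a = g.resLE (q ⁻¹ᵁ W) O le_rfl ≫ T.homOfLE (q.preimage_mono hWU) := by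
    rw [← cancel_mono (q ⁻¹ᵁ U.1).ι]
    simp [hg]
  have h2 : O.ι ≫ b = g.resLE (q ⁻¹ᵁ W) O le_rfl ≫ T.homOfLE (q.preimage_mono hWV) := by
    rw [← cancel_mono (q ⁻¹ᵁ V.1).ι]
    simp [hc]
  rw [reassoc_of% h1, reassoc_of% h2, homOfLE_relPiece π q hφ ⟨W, hW⟩ U hWU,
    homOfLE_relPiece π q hφ ⟨W, hW⟩ V hWV]

/-- If `C` is affine over `S`, a family of ring homomorphisms `Γ(C, π⁻¹ U) → Γ(T, q⁻¹ U)`,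
`U ⊆ S` affine open, that is compatible with restriction glues to a morphism `T ⟶ C`. -/
def relHom (hφ : RelCompat π q φ) : T ⟶ C := (exists_relHom π q hφ).choose

lemma ι_relHom (hφ : RelCompat π q φ) (U : S.affineOpens) :
    (q ⁻¹ᵁ U.1).ι ≫ relHom π q hφ = relPiece π q φ U :=
  (exists_relHom π q hφ).choose_spec U

/-- The glued morphism is an `S`-morphism as soon as the ring homomorphisms are
`Γ(S, U)`-linear. -/
lemma relHom_comp (hφ : RelCompat π q φ)
    (hq : ∀ U : S.affineOpens, π.app U.1 ≫ φ U = q.app U.1) : relHom π q hφ ≫ π = q := by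
  refine Scheme.Cover.hom_ext (T.openCoverOfIsOpenCover (fun U : S.affineOpens ↦ q ⁻¹ᵁ U.1)
    (.comap (iSup_affineOpens_eq_top S) q.base.1)) _ _ fun (U : S.affineOpens) ↦ ?_
  change (q ⁻¹ᵁ U.1).ι ≫ _ = (q ⁻¹ᵁ U.1).ι ≫ _
  have hU : IsAffineOpen U.1 := U.2
  have h : (affine_preimage π U).fromSpec ≫ π = Spec.map (π.app U.1) ≫ hU.fromSpec := by
    rw [Scheme.Hom.app_eq_appLE, IsAffineOpen.SpecMap_appLE_fromSpec]
  rw [← Category.assoc, ι_relHom]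
  simp only [relPiece, Category.assoc]
  rw [h, ← Spec.map_comp_assoc, hq, Scheme.Opens.toSpecΓ_naturality_assoc,
    IsAffineOpen.toSpecΓ_fromSpec, morphismRestrict_ι]

/-- The glued morphism induces the given ring homomorphisms. -/
lemma relHom_appLE (hφ : RelCompat π q φ) (U : S.affineOpens)
    (e : q ⁻¹ᵁ U.1 ≤ relHom π q hφ ⁻¹ᵁ (π ⁻¹ᵁ U.1)) :
    (relHom π q hφ).appLE (π ⁻¹ᵁ U.1) (q ⁻¹ᵁ U.1) e = φ U := by
  have h1 := Scheme.Opens.toSpecΓ_SpecMap_appLE (relHom π q hφ) (π ⁻¹ᵁ U.1) (q ⁻¹ᵁ U.1) e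
  have h2 : (q ⁻¹ᵁ U.1).toSpecΓ ≫ Spec.map ((relHom π q hφ).appLE _ _ e) =
      (q ⁻¹ᵁ U.1).toSpecΓ ≫ Spec.map (φ U) := by
    rw [h1, ← cancel_mono (affine_preimage π U).fromSpec]
    have := ι_relHom π q hφ U
    simp only [relPiece] at this
    simp [this]
  have h3 := congr(($h2).appTop)
  simp only [Scheme.Hom.comp_appTop, Scheme.Opens.toSpecΓ_appTop] at h3
  have h4 := Scheme.ΓSpecIso_naturality ((relHom π q hφ).appLE _ _ e)
  have h5 := Scheme.ΓSpecIso_naturality (φ U)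
  rw [reassoc_of% h4, reassoc_of% h5] at h3
  have h6 := (cancel_epi _).1 h3
  exact (cancel_mono _).1 h6

end Relative

/-! ### Affine cones -/

section Graded

variable {A B : Type u} [CommRing A] [CommRing B] (𝒜 : ℕ → AddSubgroup A) [GradedRing 𝒜]

/-- For a graded ring `A`, a ring homomorphism `ψ : A → B` and `t ∈ B`, the ring homomorphism
`A → B` given by `f ↦ t ^ n * ψ f` for `f` of degree `n`. -/
def twist (ψ : A →+* B) (t : B) : A →+* B :=
  (DirectSum.toSemiring
    (fun n ↦ (AddMonoidHom.mulLeft (t ^ n)).comp (ψ.toAddMonoidHom.comp (𝒜 n).subtype))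
    (by change t ^ 0 * ψ 1 = 1; simp) (by
      intro i j a b
      change t ^ (i + j) * ψ (a * b) = (t ^ i * ψ a) * (t ^ j * ψ b)
      rw [map_mul, pow_add]; ring)).comp (DirectSum.decomposeRingEquiv 𝒜).toRingHom

lemma twist_of_mem (ψ : A →+* B) (t : B) {n : ℕ} {f : A} (hf : f ∈ 𝒜 n) :
    twist 𝒜 ψ t f = t ^ n * ψ f := by
  simp only [twist, RingHom.comp_apply]
  change DirectSum.toSemiring _ _ _ (DirectSum.decompose 𝒜 f) = _
  rw [DirectSum.decompose_of_mem _ hf]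
  simp

lemma graded_hom_ext {f g : A →+* B} (h : ∀ n, ∀ a ∈ 𝒜 n, f a = g a) : f = g := by
  ext a
  induction a using DirectSum.Decomposition.inductionOn 𝒜 with
  | zero => simp
  | homogeneous a => exact h _ _ a.2
  | add a b ha hb => simp [ha, hb]

end Graded

/-- The structure of an affine cone on an affine morphism `π : C ⟶ S`: an `ℕ`-grading
`π_* 𝒪_C = ⨁ 𝒜_n` of the quasi-coherent `𝒪_S`-algebra `π_* 𝒪_C`, given by its sections
`𝒜_n(U)` over the affine open sets `U ⊆ S`, such that `𝒪_S → 𝒜_0` is an isomorphism. -/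
structure ConeGrading {C S : Scheme.{u}} (π : C ⟶ S) where
  /-- the sections of `𝒜_n` over `U` -/
  piece (U : S.affineOpens) : ℕ → AddSubgroup Γ(C, π ⁻¹ᵁ U.1)
  gradedRing (U : S.affineOpens) : GradedRing (piece U)
  map_mem (U V : S.affineOpens) (h : U ≤ V) (n : ℕ) (f : Γ(C, π ⁻¹ᵁ V.1)) (hf : f ∈ piece V n) :
    C.presheaf.map (homOfLE (π.preimage_mono h)).op f ∈ piece U n
  injective (U : S.affineOpens) : Function.Injective (π.app U.1)
  piece_zero (U : S.affineOpens) : (piece U 0 : Set Γ(C, π ⁻¹ᵁ U.1)) = Set.range (π.app U.1)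

attribute [instance] ConeGrading.gradedRing

namespace ConeGrading

variable {C S : Scheme.{u}} {π : C ⟶ S} (G : ConeGrading π)

lemma app_mem_zero (U : S.affineOpens) (g : Γ(S, U.1)) : π.app U.1 g ∈ G.piece U 0 := by
  have : π.app U.1 g ∈ (G.piece U 0 : Set _) := by rw [G.piece_zero]; exact ⟨g, rfl⟩
  exact this

lemma rangeRestrict_bijective (G : ConeGrading π) (U : S.affineOpens) :
    Function.Bijective (π.app U.1).hom.rangeRestrict :=
  have h := G.injective U
  ⟨fun _ _ e ↦ h (congrArg Subtype.val e), RingHom.rangeRestrict_surjective _⟩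

lemma projZero_mem (U : S.affineOpens) (f : Γ(C, π ⁻¹ᵁ U.1)) :
    GradedRing.projZeroRingHom (G.piece U) f ∈ (π.app U.1).hom.range := by
  have : GradedRing.projZeroRingHom (G.piece U) f ∈ (G.piece U 0 : Set _) :=
    (DirectSum.decompose (G.piece U) f 0).2
  rw [G.piece_zero] at this
  exact this

/-- The projection `⨁ 𝒜_n(U) → 𝒜_0(U) = Γ(S, U)`. -/
def zeroRing (U : S.affineOpens) : Γ(C, π ⁻¹ᵁ U.1) →+* Γ(S, U.1) :=
  (RingEquiv.ofBijective _ (G.rangeRestrict_bijective U)).symm.toRingHom.comp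
    ((GradedRing.projZeroRingHom (G.piece U)).codRestrict _ (G.projZero_mem U))

lemma app_zeroRing (U : S.affineOpens) (f : Γ(C, π ⁻¹ᵁ U.1)) :
    π.app U.1 (G.zeroRing U f) = GradedRing.projZeroRingHom (G.piece U) f :=
  congrArg Subtype.val (RingEquiv.apply_symm_apply
    (RingEquiv.ofBijective _ (G.rangeRestrict_bijective U)) ⟨_, G.projZero_mem U f⟩)

lemma zeroRing_app (U : S.affineOpens) (g : Γ(S, U.1)) : G.zeroRing U (π.app U.1 g) = g := by
  apply G.injective U
  rw [app_zeroRing]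
  exact DirectSum.decompose_of_mem_same _ (G.app_mem_zero U g)

lemma zeroRing_of_mem (U : S.affineOpens) {n : ℕ} (hn : 0 < n) {f : Γ(C, π ⁻¹ᵁ U.1)}
    (hf : f ∈ G.piece U n) : G.zeroRing U f = 0 := by
  apply G.injective U
  rw [app_zeroRing, map_zero]
  exact DirectSum.decompose_of_mem_ne _ hf hn.ne'

lemma zero_compat : RelCompat π (𝟙 S)
    (fun U ↦ CommRingCat.ofHom (G.zeroRing U) ≫ (𝟙 S : S ⟶ S).app U.1) := by
  intro U V h
  have key : (G.zeroRing U).comp (C.presheaf.map (homOfLE (π.preimage_mono h)).op).hom =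
      (S.presheaf.map (homOfLE h).op).hom.comp (G.zeroRing V) := by
    refine graded_hom_ext (G.piece V) fun n f hf ↦ ?_
    simp only [RingHom.comp_apply]
    rcases n.eq_zero_or_pos with rfl | hn
    · have hf' : f ∈ (G.piece V 0 : Set _) := hf
      rw [G.piece_zero] at hf'
      obtain ⟨g, rfl⟩ := hf'
      have := congr(($(π.naturality (homOfLE h).op)).hom g)
      rw [G.zeroRing_app]
      refine Eq.trans ?_ (G.zeroRing_app U _)
      exact congrArg (G.zeroRing U) this.symm
    · rw [G.zeroRing_of_mem V hn hf, map_zero]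
      exact G.zeroRing_of_mem U hn (G.map_mem U V h n f hf)
  have key' : C.presheaf.map (homOfLE (π.preimage_mono h)).op ≫ CommRingCat.ofHom (G.zeroRing U) =
      CommRingCat.ofHom (G.zeroRing V) ≫ S.presheaf.map (homOfLE h).op :=
    CommRingCat.hom_ext key
  rw [reassoc_of% key', Category.assoc]
  congr 1

lemma gm_compat {T : Scheme.{u}} (t : Γ(T, ⊤)) (x : T ⟶ C) : RelCompat π (x ≫ π)
    (fun U ↦ CommRingCat.ofHom (twist (G.piece U)
      (x.appLE (π ⁻¹ᵁ U.1) ((x ≫ π) ⁻¹ᵁ U.1) le_rfl).hom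
      (T.presheaf.map (homOfLE le_top).op t))) := by
  intro U V h
  refine CommRingCat.hom_ext (graded_hom_ext (G.piece V) fun n f hf ↦ ?_)
  simp only [CommRingCat.hom_comp, RingHom.comp_apply, CommRingCat.hom_ofHom]
  rw [twist_of_mem _ _ _ hf]
  refine (twist_of_mem (G.piece U) _ _ (G.map_mem U V h n f hf)).trans ?_
  rw [map_mul, map_pow]
  congr 1
  · congr 1
    have := T.presheaf.map_comp (homOfLE (le_top : (x ≫ π) ⁻¹ᵁ V.1 ≤ ⊤)).op
      (homOfLE ((x ≫ π).preimage_mono h)).op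
    exact congr(($this).hom t)
  · have h1 := x.map_appLE (U := π ⁻¹ᵁ U.1) (U' := π ⁻¹ᵁ V.1) (V := (x ≫ π) ⁻¹ᵁ U.1) le_rfl
      (homOfLE (π.preimage_mono h)).op
    have h2 := x.appLE_map (U := π ⁻¹ᵁ V.1) (V := (x ≫ π) ⁻¹ᵁ V.1) (V' := (x ≫ π) ⁻¹ᵁ U.1) le_rfl
      (homOfLE ((x ≫ π).preimage_mono h)).op
    exact congr(($(h1.trans h2.symm)).hom f)

variable [IsAffineHom π]

/-- The zero section `S ⟶ C`: the embedding of the closed subscheme `Z = 𝕍(⨁_{n > 0} 𝒜_n)`,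
identified with `S` through `π`. Over `U ⊆ S` affine open it is the projection
`⨁ 𝒜_n(U) → 𝒜_0(U) = Γ(S, U)`. -/
def zeroSection : S ⟶ C := relHom π (𝟙 S) G.zero_compat

lemma zeroSection_comp : G.zeroSection ≫ π = 𝟙 S :=
  relHom_comp π (𝟙 S) G.zero_compat fun U ↦ by
    rw [← Category.assoc]
    have : π.app U.1 ≫ CommRingCat.ofHom (G.zeroRing U) = 𝟙 _ :=
      CommRingCat.hom_ext (RingHom.ext fun g ↦ G.zeroRing_app U g)
    rw [this, Category.id_comp]

/-- Over `π⁻¹ U` the zero section is cut out by the ideal `⨁_{n > 0} 𝒜_n(U)`. -/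
lemma zeroSection_ker (U : S.affineOpens) (e : U.1 ≤ G.zeroSection ⁻¹ᵁ (π ⁻¹ᵁ U.1))
    (f : Γ(C, π ⁻¹ᵁ U.1)) : G.zeroSection.appLE (π ⁻¹ᵁ U.1) U.1 e f = 0 ↔
      f ∈ HomogeneousIdeal.irrelevant (G.piece U) := by
  have h : G.zeroSection.appLE (π ⁻¹ᵁ U.1) U.1 e = CommRingCat.ofHom (G.zeroRing U) := by
    have := relHom_appLE π (𝟙 S) G.zero_compat U e
    refine Eq.trans this ?_
    simp only [Scheme.Hom.id_app]
    exact Category.comp_id _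
  rw [h, HomogeneousIdeal.mem_irrelevant_iff]
  change G.zeroRing U f = 0 ↔ GradedRing.projZeroRingHom (G.piece U) f = 0
  rw [← G.app_zeroRing, map_eq_zero_iff _ (G.injective U)]

/-- The `𝔾_m`-action on the affine cone `C`, on `T`-valued points: for `t ∈ 𝔾_m(T) = Γ(T, ⊤)ˣ`
and `x ∈ C(T)`, the point `t.x` lies over the same point of `S` as `x`, and
`f (t.x) = t ^ n * f x` for `f ∈ 𝒜_n`. -/
def gm {T : Scheme.{u}} (t : Γ(T, ⊤)ˣ) (x : T ⟶ C) : T ⟶ C :=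
  relHom π (x ≫ π) (G.gm_compat (t : Γ(T, ⊤)) x)

lemma gm_comp {T : Scheme.{u}} (t : Γ(T, ⊤)ˣ) (x : T ⟶ C) : G.gm t x ≫ π = x ≫ π :=
  relHom_comp π (x ≫ π) (G.gm_compat (t : Γ(T, ⊤)) x) fun U ↦ by
    refine CommRingCat.hom_ext (RingHom.ext fun g ↦ ?_)
    simp only [CommRingCat.hom_comp, RingHom.comp_apply, CommRingCat.hom_ofHom]
    refine (twist_of_mem (G.piece U) _ _ (G.app_mem_zero U g)).trans ?_
    rw [pow_zero, one_mul]
    rw [← Scheme.Hom.appLE_eq_app (x ≫ π), Scheme.Hom.comp_appLE]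
    rfl

lemma gm_appLE {T : Scheme.{u}} (t : Γ(T, ⊤)ˣ) (x : T ⟶ C) (U : S.affineOpens)
    (e : (x ≫ π) ⁻¹ᵁ U.1 ≤ G.gm t x ⁻¹ᵁ (π ⁻¹ᵁ U.1)) (n : ℕ) (f : Γ(C, π ⁻¹ᵁ U.1))
    (hf : f ∈ G.piece U n) :
    (G.gm t x).appLE (π ⁻¹ᵁ U.1) ((x ≫ π) ⁻¹ᵁ U.1) e f =
      T.presheaf.map (homOfLE le_top).op (t : Γ(T, ⊤)) ^ n *
        x.appLE (π ⁻¹ᵁ U.1) ((x ≫ π) ⁻¹ᵁ U.1) le_rfl f := by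
  have := relHom_appLE π (x ≫ π) (G.gm_compat (t : Γ(T, ⊤)) x) U e
  exact congr(($this).hom f).trans (twist_of_mem (G.piece U) _ _ hf)

end ConeGrading

/-! ### Actions of `𝔾_a^r` -/

/-- The structure homomorphism `k → Γ(X, ⊤)` of a `k`-scheme `X`. -/
def scalar {k : Type u} [Field k] {X : Scheme.{u}} (p : X ⟶ Spec (.of k)) : k →+* Γ(X, ⊤) :=
  ((Scheme.ΓSpecIso (.of k)).inv ≫ p.appTop).hom

/-- An action of `𝔾_a^ι` (`ι` finite; `𝔾_a^r` for `r = |ι|`) on the `k`-scheme `p : C ⟶ Spec k`.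
The product `𝔾_a^ι ×_k C` is the affine space `𝔸(ι; C)`, whose `T`-valued points are pairs of
`u ∈ 𝔾_a^ι(T) = Γ(T, ⊤) ^ ι` and `x ∈ C(T)`; the axioms of an action are stated on
`T`-valued points. -/
structure GaAction {k : Type u} [Field k] (ι : Type u) {C : Scheme.{u}}
    (p : C ⟶ Spec (.of k)) where
  /-- the action morphism `𝔾_a^ι ×_k C ⟶ C` -/
  act : 𝔸(ι; C) ⟶ C
  act_over : act ≫ p = (𝔸(ι; C) ↘ C) ≫ p
  zero_act {T : Scheme.{u}} (x : T ⟶ C) : AffineSpace.homOfVector x 0 ≫ act = x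
  add_act {T : Scheme.{u}} (u v : ι → Γ(T, ⊤)) (x : T ⟶ C) :
    AffineSpace.homOfVector x (u + v) ≫ act =
      AffineSpace.homOfVector (AffineSpace.homOfVector x v ≫ act) u ≫ act

namespace GaAction

variable {k : Type u} [Field k] {ι : Type u} {C : Scheme.{u}} {p : C ⟶ Spec (.of k)}
  (σ : GaAction ι p)

/-- `u.x` for `u ∈ 𝔾_a^ι(T)` and `x ∈ C(T)`. -/
def smul {T : Scheme.{u}} (u : ι → Γ(T, ⊤)) (x : T ⟶ C) : T ⟶ C :=
  AffineSpace.homOfVector x u ≫ σ.act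

lemma zero_smul {T : Scheme.{u}} (x : T ⟶ C) : σ.smul 0 x = x := σ.zero_act x

lemma add_smul {T : Scheme.{u}} (u v : ι → Γ(T, ⊤)) (x : T ⟶ C) :
    σ.smul (u + v) x = σ.smul u (σ.smul v x) := σ.add_act u v x

lemma comp_smul {T T' : Scheme.{u}} (g : T' ⟶ T) (u : ι → Γ(T, ⊤)) (x : T ⟶ C) :
    g ≫ σ.smul u x = σ.smul (fun i ↦ g.appTop (u i)) (g ≫ x) := by
  rw [smul, ← Category.assoc, AffineSpace.comp_homOfVector]
  rfl

/-- The morphism `Spec k[ε] ⟶ Spec k`. -/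
def dualBase (k : Type u) [Field k] : Spec (.of (DualNumber k)) ⟶ Spec (.of k) :=
  Spec.map (CommRingCat.ofHom (algebraMap k (DualNumber k)))

/-- The element `ε ξ` of `𝔾_a^ι(k[ε])`, for `ξ` in the Lie algebra `𝔲 = k^ι` of `𝔾_a^ι`. -/
def dualVec (ξ : ι → k) : ι → Γ(Spec (.of (DualNumber k)), ⊤) :=
  fun i ↦ (Scheme.ΓSpecIso (.of (DualNumber k))).inv (TrivSqZeroExt.inr (ξ i) : DualNumber k)

lemma dualVec_zero : dualVec (0 : ι → k) = 0 := by
  funext i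
  change (Scheme.ΓSpecIso (.of (DualNumber k))).inv (TrivSqZeroExt.inr (0 : k) : DualNumber k) = 0
  rw [TrivSqZeroExt.inr_zero, map_zero]

lemma dualVec_add (ξ η : ι → k) : dualVec (ξ + η) = dualVec ξ + dualVec η := by
  funext i
  change (Scheme.ΓSpecIso (.of (DualNumber k))).inv
    (TrivSqZeroExt.inr (ξ i + η i) : DualNumber k) = _
  rw [TrivSqZeroExt.inr_add, map_add]
  rfl

/-- The `k`-algebra endomorphism `ε ↦ c ε` of `k[ε]`. -/
def dualScale (c : k) : DualNumber k →ₐ[k] DualNumber k :=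
  TrivSqZeroExt.map (c • LinearMap.id)

lemma dualScale_base (c : k) :
    Spec.map (CommRingCat.ofHom (dualScale c).toRingHom) ≫ dualBase k = dualBase k := by
  rw [dualBase, ← Spec.map_comp]
  congr 1
  exact CommRingCat.hom_ext (RingHom.ext fun a ↦ (dualScale c).commutes a)

lemma dualScale_dualVec (c : k) (ξ : ι → k) (i : ι) :
    (Spec.map (CommRingCat.ofHom (dualScale c).toRingHom)).appTop (dualVec ξ i) =
      dualVec (c • ξ) i := by
  have h := Scheme.ΓSpecIso_inv_naturality (CommRingCat.ofHom (dualScale c).toRingHom)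
  refine congr(($h).hom (TrivSqZeroExt.inr (ξ i) : DualNumber k)).symm.trans ?_
  change (Scheme.ΓSpecIso (.of (DualNumber k))).inv (dualScale c (TrivSqZeroExt.inr (ξ i))) = _
  rw [dualScale, TrivSqZeroExt.map_inr]
  rfl

/-- The Lie algebra stabiliser `Stab_𝔲(x) ⊆ 𝔲 = k^ι` of `x ∈ C(k)`, i.e. the Lie algebra of the
stabiliser group scheme of `x`: all `ξ` such that `ε ξ ∈ 𝔾_a^ι(k[ε])` fixes `x ∈ C(k[ε])`. -/
def stab (x : Spec (.of k) ⟶ C) : Submodule k (ι → k) where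
  carrier := {ξ | σ.smul (dualVec ξ) (dualBase k ≫ x) = dualBase k ≫ x}
  zero_mem' := by
    change σ.smul (dualVec 0) (dualBase k ≫ x) = dualBase k ≫ x
    rw [dualVec_zero, zero_smul]
  add_mem' {ξ η} hξ hη := by
    change σ.smul (dualVec (ξ + η)) (dualBase k ≫ x) = dualBase k ≫ x
    rw [dualVec_add, add_smul, show σ.smul (dualVec η) (dualBase k ≫ x) = _ from hη]
    exact hξ
  smul_mem' c ξ hξ := by
    have h : σ.smul (dualVec ξ) (dualBase k ≫ x) = dualBase k ≫ x := hξ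
    have h' := congr(Spec.map (CommRingCat.ofHom (dualScale c).toRingHom) ≫ $h)
    rw [comp_smul, ← Category.assoc, dualScale_base, funext (dualScale_dualVec c ξ)] at h'
    exact h'

/-- The morphism `𝔾_a^ι ×_k Z ⟶ C`, `(u, z) ↦ u.z`, for `i : Z ⟶ C`. -/
def sweep {Z : Scheme.{u}} (i : Z ⟶ C) : 𝔸(ι; Z) ⟶ C :=
  AffineSpace.map ι i ≫ σ.act

/-! Let `β` be a basis, indexed by `κ`, of a subspace `𝔳 ⊆ 𝔲 = k^ι`. The corresponding subgroup
`U' ⊆ 𝔾_a^ι` is the image of `𝔾_a^κ ↪ 𝔾_a^ι`, `c ↦ ∑ j, c_j β_j`. -/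

variable {κ : Type u} [Fintype κ]

/-- The point `∑ j, c_j β_j` of `U'(X) ⊆ 𝔾_a^ι(X)`, for `c_j ∈ Γ(X, ⊤)`. -/
def lin {X : Scheme.{u}} (q : X ⟶ Spec (.of k)) (β : κ → ι → k) (c : κ → Γ(X, ⊤)) :
    ι → Γ(X, ⊤) :=
  fun i ↦ ∑ j, scalar q (β j i) * c j

/-- The inclusion `U' ×_k X ⟶ 𝔾_a^ι ×_k X`. -/
def subgroupHom {X : Scheme.{u}} (q : X ⟶ Spec (.of k)) (β : κ → ι → k) : 𝔸(κ; X) ⟶ 𝔸(ι; X) :=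
  AffineSpace.homOfVector (𝔸(κ; X) ↘ X) (lin ((𝔸(κ; X) ↘ X) ≫ q) β (AffineSpace.coord X))

/-- The morphism `U' ×_k Z ⟶ C`, `(u, z) ↦ u.z`, for `i : Z ⟶ C`. -/
def subSweep (β : κ → ι → k) {Z : Scheme.{u}} (i : Z ⟶ C) : 𝔸(κ; Z) ⟶ C :=
  subgroupHom (i ≫ p) β ≫ σ.sweep i

/-- `U'` acts freely on the open subscheme `W` of `C`: on `T`-valued points, for every
scheme `T`, an element of `U'(T)` that fixes a point of `W(T)` is trivial. -/
def ActsFreelyOn (β : κ → ι → k) (W : C.Opens) : Prop :=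
  ∀ (T : Scheme.{u}) (x : T ⟶ C), x ⁻¹ᵁ W = ⊤ → ∀ c : κ → Γ(T, ⊤),
    σ.smul (lin (x ≫ p) β c) x = x → lin (x ≫ p) β c = 0

end GaAction

/-! ### The situation of a graded additive group acting on an affine cone -/

/-- `p : X ⟶ Spec k` is a variety: an integral scheme, separated and of finite type over `k`. -/
structure IsVariety {k : Type u} [Field k] {X : Scheme.{u}} (p : X ⟶ Spec (.of k)) : Prop where
  isIntegral : IsIntegral X
  isSeparated : IsSeparated p
  locallyOfFiniteType : LocallyOfFiniteType p
  quasiCompact : QuasiCompact p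

section Situation

variable {k : Type u} [Field k] {ι : Type u} {C S : Scheme.{u}} {p : S ⟶ Spec (.of k)}
  {π : C ⟶ S} [IsAffineHom π] (G : ConeGrading π) (σ : GaAction ι (π ≫ p))

/-- The actions of `𝔾_a^ι` and of `𝔾_m` on the cone constitute an action of
`𝔾_a^ι ⋊_w 𝔾_m`, where `𝔾_m` acts on `𝔾_a^ι` with weight `w`: `t.(u.x) = (t ^ w u).(t.x)`. -/
def IsSemidirect (w : ℕ) : Prop :=
  ∀ (T : Scheme.{u}) (t : Γ(T, ⊤)ˣ) (u : ι → Γ(T, ⊤)) (x : T ⟶ C),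
    G.gm t (σ.smul u x) = σ.smul (fun i ↦ (t : Γ(T, ⊤)) ^ w * u i) (G.gm t x)

/-- `d(π) = min_{z ∈ Z} dim Stab_𝔲(z)`, over the `k`-points `z` of the zero section. -/
def minStabDim : ℕ :=
  sInf {d | ∃ z : Spec (.of k) ⟶ S, z ≫ p = 𝟙 _ ∧
    Module.finrank k (σ.stab (z ≫ G.zeroSection)) = d}

end Situation

end GradedAdditive
end

open GradedAdditive

/-!
Over an affine open `V` of `S`, a function `f` of degree equal to the weight `w` restricts to an
affine-linear function on each orbit, `f (u.x) = f x + ∑ l, u l * D_l f (x)`, where the derivative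
`D_l f` has degree `0` and hence is a function on `V`. Moreover `f` vanishes on the zero section,
and a function of any other degree has derivative `0` there. So near a `k`-point `z` of `S` there
are functions `f j` of degree `w` dual to a basis of a complement `𝔳` of `Stab z`. Their values
recover the coordinates of `u ∈ U'` from `x` and `u.x`; thus `U'` acts freely, and together with
`π` they define a retraction of `U' × Z_V ⟶ C_V`, which is therefore a closed immersion.

The rank of the differentials at the zero section is constant and `S` is reduced, so the
differential of any function is a combination of those of the `f j`, identically over `V`. Hence
for every `u` there is `v ∈ U'`, with coordinates linear in `u`, such that `u - v` stabilises the
zero section infinitesimally. In characteristic zero `u - v` then fixes the zero section, over any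
base, because the functions `t ↦ g (t (u - v).z)` are polynomials with derivative `0`. Consequently
`𝔾_a^r × Z_V ⟶ C_V` and `U' × Z_V ⟶ C_V` factor through each other.
-/

noncomputable section

namespace GradedAdditive

/-! ### Graded coactions of `𝔾_a^ι` -/

section Coaction

open MvPolynomial

variable {A : Type u} [CommRing A] {ι : Type u}

/-- The `l`-th fundamental vector field of the `𝔾_a^ι`-action on `Spec A` with coaction `ρ`: the
derivative of `ρ` at the origin of `𝔾_a^ι` in the direction `l`. -/
def vectorField (ρ : A →+* MvPolynomial ι A) (l : ι) : A →+ A :=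
  (coeffAddMonoidHom (Finsupp.single l 1)).comp ρ.toAddMonoidHom

lemma vectorField_apply (ρ : A →+* MvPolynomial ι A) (l : ι) (g : A) :
    vectorField ρ l g = coeff (Finsupp.single l 1) (ρ g) := rfl

lemma eval₂_of_mul_eq_zero [Fintype ι] {B : Type*} [CommRing B] (φ : A →+* B) {v : ι → B}
    (hv : ∀ i j, v i * v j = 0) (P : MvPolynomial ι A) :
    eval₂ φ v P = φ (coeff 0 P) + ∑ l, v l * φ (coeff (Finsupp.single l 1) P) := by
  classical
  induction P using MvPolynomial.induction_on with
  | C a => simp [coeff_C, eq_comm]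
  | add P Q hP hQ =>
    simp only [eval₂_add, hP, hQ, coeff_add, map_add, mul_add, Finset.sum_add_distrib]
    ring
  | mul_X P i hP =>
    have hsq : ∑ l, v l * φ (coeff (Finsupp.single l 1) P) * v i = 0 :=
      Finset.sum_eq_zero fun l _ ↦ by rw [mul_right_comm, hv, zero_mul]
    rw [eval₂_mul, eval₂_X, hP, add_mul, Finset.sum_mul, hsq, Finset.sum_eq_single i]
    · simp [coeff_mul_X', mul_comm]
    · intro l _ hl
      simp [coeff_mul_X', Ne.symm hl]
    · simp

/-- The algebraic form of a `𝔾_a^ι`-action on `Spec A`, for a graded ring `A`, that is compatible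
with the `𝔾_m`-action given by the grading, where `𝔾_m` acts on `𝔾_a^ι` with weight `w`. The group
law and the weight are expressed through points with values in arbitrary rings `B`. -/
structure IsGradedCoaction (𝒜 : ℕ → AddSubgroup A) [GradedRing 𝒜] (w : ℕ)
    (ρ : A →+* MvPolynomial ι A) : Prop where
  coeff_zero (g : A) : coeff 0 (ρ g) = g
  add {B : Type u} [CommRing B] (φ : A →+* B) (u v : ι → B) (g : A) :
    eval₂ φ (u + v) (ρ g) = eval₂ ((eval₂Hom φ v).comp ρ) u (ρ g)
  twist {B : Type u} [CommRing B] (t : Bˣ) (φ : A →+* B) (u : ι → B) (g : A) :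
    twist 𝒜 ((eval₂Hom φ u).comp ρ) (t : B) g =
      eval₂ (twist 𝒜 φ (t : B)) (fun i ↦ (t : B) ^ w * u i) (ρ g)

variable {𝒜 : ℕ → AddSubgroup A} [GradedRing 𝒜]

lemma comp_twist {B B' : Type u} [CommRing B] [CommRing B'] (h : B →+* B') (φ : A →+* B) (t : B) :
    h.comp (twist 𝒜 φ t) = twist 𝒜 (h.comp φ) (h t) := by
  refine graded_hom_ext 𝒜 fun n f hf ↦ ?_
  rw [RingHom.comp_apply, twist_of_mem 𝒜 _ _ hf, twist_of_mem 𝒜 _ _ hf, map_mul, map_pow,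
    RingHom.comp_apply]

lemma eval₂_twist_monomial (w : ℕ) (β : ι →₀ ℕ) {n : ℕ} {a : A} (ha : a ∈ 𝒜 n) :
    eval₂ (twist 𝒜 ((Polynomial.C).comp (C : A →+* MvPolynomial ι A)) Polynomial.X)
      (fun i ↦ Polynomial.X ^ w * Polynomial.C (X i)) (monomial β a) =
      Polynomial.C (monomial β a) * Polynomial.X ^ (w * β.degree + n) := by
  have hβ : (β.prod fun i e ↦
      (Polynomial.X ^ w * Polynomial.C (X i) : Polynomial (MvPolynomial ι A)) ^ e) =
      Polynomial.X ^ (w * β.degree) * Polynomial.C (monomial β 1) := by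
    simp only [mul_pow, Finsupp.prod_mul, ← pow_mul, ← map_pow]
    congr 1
    · rw [Finsupp.prod, Finset.prod_pow_eq_pow_sum, Finsupp.degree_apply, Finset.mul_sum]
    · rw [monomial_eq, C_1, one_mul, Finsupp.prod, Finsupp.prod, map_prod]
  have ha' : (monomial β a : MvPolynomial ι A) = C a * monomial β 1 := by
    rw [C_mul_monomial, mul_one]
  rw [eval₂_monomial, hβ, twist_of_mem 𝒜 _ _ ha, RingHom.comp_apply, ha', map_mul]
  ring

/-- The exponent of `t` records the weight of a term, that of `X_i` being `w`. -/
lemma coeff_eval₂_twist (w : ℕ) (P : MvPolynomial ι A) (α : ι →₀ ℕ) (m : ℕ) :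
    coeff α ((eval₂ (twist 𝒜 ((Polynomial.C).comp (C : A →+* MvPolynomial ι A)) Polynomial.X)
      (fun i ↦ Polynomial.X ^ w * Polynomial.C (X i)) P).coeff (w * α.degree + m)) =
      DirectSum.decompose 𝒜 (coeff α P) m := by
  classical
  induction P using MvPolynomial.induction_on' with
  | monomial β a =>
    induction a using DirectSum.Decomposition.inductionOn 𝒜 with
    | zero => simp
    | @homogeneous n a =>
      rw [eval₂_twist_monomial w β a.2, Polynomial.coeff_C_mul_X_pow, apply_ite (coeff α),
        coeff_monomial, coeff_zero]
      rcases eq_or_ne β α with rfl | hβ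
      · rcases eq_or_ne m n with rfl | hm
        · simp
        · rw [if_pos rfl, DirectSum.decompose_of_mem_ne 𝒜 a.2 hm.symm, if_neg (by lia)]
      · simp [hβ]
    | add a b ha hb =>
      rw [map_add, eval₂_add, Polynomial.coeff_add, coeff_add, ha, hb, coeff_add,
        DirectSum.decompose_add]
      rfl
  | add P Q hP hQ =>
    rw [eval₂_add, Polynomial.coeff_add, coeff_add, hP, hQ, coeff_add, DirectSum.decompose_add]
    rfl

namespace IsGradedCoaction

variable {w : ℕ} {ρ : A →+* MvPolynomial ι A} (hρ : IsGradedCoaction 𝒜 w ρ)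
include hρ

/-- The compatibility with the grading, for the universal point of `𝔾_a^ι × Spec A` and `t` the
coordinate on `𝔾_m`. -/
lemma C_mul_X_pow_eq_eval₂_twist {n : ℕ} {f : A} (hf : f ∈ 𝒜 n) :
    Polynomial.C (ρ f) * Polynomial.X ^ n =
      eval₂ (GradedAdditive.twist 𝒜 ((Polynomial.C).comp (C : A →+* MvPolynomial ι A))
        Polynomial.X) (fun i ↦ Polynomial.X ^ w * Polynomial.C (X i)) (ρ f) := by
  let c := (Polynomial.C).comp (C : A →+* MvPolynomial ι A)
  let e := Polynomial.toLaurent (R := MvPolynomial ι A)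
  have ht : IsUnit (e Polynomial.X) :=
    Polynomial.toLaurent_X (R := MvPolynomial ι A) ▸ LaurentPolynomial.isUnit_T 1
  have huniv : Polynomial.C (ρ f) = eval₂ c (fun i ↦ Polynomial.C (X i)) (ρ f) := by
    conv_lhs => rw [← eval₂_eta (ρ f)]
    exact hom_eval₂ _ _ Polynomial.C _
  apply Polynomial.toLaurent_injective
  have h := hρ.twist ht.unit (e.comp c) (fun i ↦ e (Polynomial.C (X i))) f
  rw [twist_of_mem 𝒜 _ _ hf, IsUnit.unit_spec, ← comp_twist, RingHom.comp_apply,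
    coe_eval₂Hom] at h
  simp only [← map_pow, ← map_mul] at h
  rw [mul_comm, huniv, map_mul, hom_eval₂, hom_eval₂, ← h, map_pow, mul_comm]

lemma decompose_coeff {n : ℕ} {f : A} (hf : f ∈ 𝒜 n) (α : ι →₀ ℕ) {m : ℕ}
    (hm : w * α.degree + m ≠ n) : (DirectSum.decompose 𝒜 (coeff α (ρ f)) m : A) = 0 := by
  rw [← coeff_eval₂_twist w (ρ f) α m, ← hρ.C_mul_X_pow_eq_eval₂_twist hf,
    Polynomial.coeff_C_mul_X_pow, if_neg hm, MvPolynomial.coeff_zero]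

lemma coeff_eq_zero {n : ℕ} {f : A} (hf : f ∈ 𝒜 n) {α : ι →₀ ℕ} (hα : n < w * α.degree) :
    coeff α (ρ f) = 0 := by
  classical
  rw [← DirectSum.sum_support_decompose 𝒜 (coeff α (ρ f))]
  exact Finset.sum_eq_zero fun m _ ↦ hρ.decompose_coeff hf α (by lia)

lemma vectorField_mem {f : A} (hf : f ∈ 𝒜 w) (l : ι) : vectorField ρ l f ∈ 𝒜 0 := by
  classical
  rw [vectorField_apply, ← DirectSum.sum_support_decompose 𝒜 (coeff (Finsupp.single l 1) (ρ f))]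
  refine sum_mem fun m _ ↦ ?_
  rcases eq_or_ne m 0 with rfl | hm
  · exact SetLike.coe_mem _
  · rw [hρ.decompose_coeff hf _ (by simpa using hm)]
    exact zero_mem _

lemma eval₂_of_mem [Fintype ι] (hw : 0 < w) {B : Type*} [CommRing B] (φ : A →+* B) (u : ι → B)
    {f : A} (hf : f ∈ 𝒜 w) :
    eval₂ φ u (ρ f) = φ f + ∑ l, u l * φ (vectorField ρ l f) := by
  classical
  have h : ρ f = C f + ∑ l, C (vectorField ρ l f) * X l := by
    ext α
    simp only [coeff_add, coeff_sum, coeff_C, coeff_C_mul, coeff_X, mul_ite, mul_one, mul_zero]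
    rcases eq_or_ne α 0 with rfl | h0
    · simp [hρ.coeff_zero]
    rw [if_neg h0.symm, zero_add]
    by_cases h1 : α ∈ Set.range fun l : ι ↦ Finsupp.single l 1
    · obtain ⟨l, rfl⟩ := h1
      simp [Finsupp.single_left_inj, vectorField_apply]
    · rw [Finset.sum_eq_zero fun l _ ↦ if_neg fun h ↦ h1 ⟨l, h⟩]
      have h0' : α.degree ≠ 0 := by rwa [Ne, Finsupp.degree_eq_zero_iff]
      have h1' : α.degree ≠ 1 := by rwa [Finsupp.range_single_one] at h1
      exact hρ.coeff_eq_zero hf (by nlinarith [show 2 ≤ α.degree by lia])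
  conv_lhs => rw [h]
  simp [eval₂_sum, mul_comm]

lemma apply_of_mem_zero (hw : 0 < w) {a : A} (ha : a ∈ 𝒜 0) : ρ a = C a := by
  classical
  ext α
  rw [coeff_C]
  split_ifs with h
  · rw [← h, hρ.coeff_zero]
  · refine hρ.coeff_eq_zero ha (Nat.mul_pos hw (Nat.pos_of_ne_zero ?_))
    rwa [Ne, Finsupp.degree_eq_zero_iff, eq_comm]

lemma eval₂Hom_comp_of_mul_eq_zero [Fintype ι] {B : Type*} [CommRing B] (φ : A →+* B) {v : ι → B}
    (hv : ∀ i j, v i * v j = 0) (hφ : ∀ g, ∑ l, v l * φ (vectorField ρ l g) = 0) :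
    (eval₂Hom φ v).comp ρ = φ := by
  ext g
  rw [RingHom.comp_apply, coe_eval₂Hom, eval₂_of_mul_eq_zero φ hv, hρ.coeff_zero]
  exact add_eq_left.2 (hφ g)

end IsGradedCoaction

/-- For a point `φ : A →+* B` and a vector `ξ`, the polynomial `z ↦ g ((z • ξ) • φ)`, where
`P` is the image of the function `g` under the coaction. -/
def orbitPolynomial {B : Type*} [CommRing B] (φ : A →+* B) (ξ : ι → B) (P : MvPolynomial ι A) :
    Polynomial B :=
  eval₂ ((Polynomial.C).comp φ) (fun i ↦ Polynomial.C (ξ i) * Polynomial.X) P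

lemma aeval_orbitPolynomial {B B' : Type*} [CommRing B] [CommRing B'] [Algebra B B'] (φ : A →+* B)
    (ξ : ι → B) (P : MvPolynomial ι A) (z : B') :
    Polynomial.aeval z (orbitPolynomial φ ξ P) =
      eval₂ ((algebraMap B B').comp φ) (fun i ↦ algebraMap B B' (ξ i) * z) P := by
  rw [orbitPolynomial, ← AlgHom.coe_toRingHom, hom_eval₂]
  congr 1
  · ext a; simp
  · ext i; simp

lemma derivative_eq_zero_of_aeval_X_add_eps {B : Type*} [CommRing B] {F : Polynomial B}
    (h : Polynomial.aeval (TrivSqZeroExt.inl Polynomial.X + DualNumber.eps :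
      DualNumber (Polynomial B)) F = Polynomial.aeval (TrivSqZeroExt.inl Polynomial.X) F) :
    Polynomial.derivative F = 0 := by
  have hinl (P : Polynomial B) : Polynomial.aeval
      (TrivSqZeroExt.inl Polynomial.X : DualNumber (Polynomial B)) P = TrivSqZeroExt.inl P := by
    rw [← TrivSqZeroExt.algebraMap_eq_inl, Polynomial.aeval_algebraMap_apply,
      Polynomial.aeval_X_left_apply]
  rw [Polynomial.aeval_add_of_sq_eq_zero _ _ _ (by rw [sq, DualNumber.eps_mul_eps]),
    add_eq_left, hinl] at h
  simpa using congrArg TrivSqZeroExt.snd h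

namespace IsGradedCoaction

variable {w : ℕ} {ρ : A →+* MvPolynomial ι A} (hρ : IsGradedCoaction 𝒜 w ρ) [Fintype ι]
  {B : Type u} [CommRing B] (φ : A →+* B) {ξ : ι → B}
  (hξ : ∀ g, ∑ l, ξ l * φ (vectorField ρ l g) = 0)
include hρ hξ

lemma derivative_orbitPolynomial (g : A) :
    Polynomial.derivative (orbitPolynomial φ ξ (ρ g)) = 0 := by
  let D := DualNumber (Polynomial B)
  let c := algebraMap B D
  let x : D := TrivSqZeroExt.inl Polynomial.X
  let ε : D := DualNumber.eps
  refine derivative_eq_zero_of_aeval_X_add_eps ?_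
  have hfix : (eval₂Hom (c.comp φ) (fun i ↦ c (ξ i) * ε)).comp ρ = c.comp φ := by
    refine hρ.eval₂Hom_comp_of_mul_eq_zero _ (fun i j ↦ ?_) fun g ↦ ?_
    · rw [mul_mul_mul_comm, DualNumber.eps_mul_eps, mul_zero]
    · simp_rw [RingHom.comp_apply, mul_right_comm _ ε, ← map_mul, ← Finset.sum_mul, ← map_sum, hξ,
        map_zero, zero_mul]
  have hadd := hρ.add (c.comp φ) (fun i ↦ c (ξ i) * x) (fun i ↦ c (ξ i) * ε) g
  rw [hfix] at hadd
  rw [aeval_orbitPolynomial, aeval_orbitPolynomial, ← hadd]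
  simp only [mul_add]
  rfl

/-- The orbit polynomial of a point at which `ξ` vanishes infinitesimally has zero derivative; in
characteristic zero it is therefore constant. -/
lemma eval₂_eq_of_sum_vectorField_eq_zero [IsAddTorsionFree B] (g : A) :
    eval₂ φ ξ (ρ g) = φ g := by
  obtain ⟨a, ha⟩ := Polynomial.natDegree_eq_zero.1
    (Polynomial.derivative_eq_zero.1 (hρ.derivative_orbitPolynomial φ hξ g))
  have horbit (z : B) : eval₂ φ (fun i ↦ ξ i * z) (ρ g) = a := by
    simpa [← ha] using (aeval_orbitPolynomial φ ξ (ρ g) z).symm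
  calc eval₂ φ ξ (ρ g) = eval₂ φ (fun i ↦ ξ i * 0) (ρ g) := by
        rw [horbit, ← horbit 1]; simp only [mul_one]
    _ = φ g := by
        simp only [mul_zero]
        exact (eval₂Hom_zero'_apply φ (ρ g)).trans (congrArg φ (hρ.coeff_zero g))

end IsGradedCoaction

end Coaction

section DualFamily

open Module

variable {k W κ : Type*} [Field k] [AddCommGroup W] [Module k W] [DecidableEq κ]

lemma exists_dual_family [FiniteDimensional k W] {φ : κ → Dual k W} (hφ : LinearIndependent k φ) :
    ∃ β : κ → W, ∀ i j, φ j (β i) = if i = j then 1 else 0 := by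
  obtain ⟨h, hh⟩ := LinearMap.exists_leftInverse_of_injective (Finsupp.linearCombination k φ)
    (LinearMap.ker_eq_bot.2 hφ)
  refine ⟨fun i ↦ (evalEquiv k W).symm (Finsupp.lapply i ∘ₗ h), fun i j ↦ ?_⟩
  have hj : h (φ j) = Finsupp.single j 1 := by
    simpa using LinearMap.congr_fun hh (Finsupp.single j 1)
  rw [apply_evalEquiv_symm_apply, LinearMap.comp_apply, hj, Finsupp.lapply_apply,
    Finsupp.single_apply]
  simp only [eq_comm]

variable {φ : κ → Dual k W} {β : κ → W} (hφβ : ∀ i j, φ j (β i) = if i = j then 1 else 0)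
include hφβ

lemma apply_sum_smul_of_dual [Fintype κ] (c : κ → k) (j : κ) : φ j (∑ i, c i • β i) = c j := by
  simp [hφβ]

lemma linearIndependent_of_dual [Finite κ] : LinearIndependent k β := by
  cases nonempty_fintype κ
  refine Fintype.linearIndependent_iff.2 fun c hc j ↦ ?_
  rw [← apply_sum_smul_of_dual hφβ c j, hc, map_zero]

variable [Fintype κ] [FiniteDimensional k W] {Φ : Submodule k (Dual k W)} (hφ : ∀ j, φ j ∈ Φ)
  (hcard : Fintype.card κ + finrank k Φ.dualCoannihilator = finrank k W)
include hφ hcard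

lemma isCompl_span_dualCoannihilator :
    IsCompl (Submodule.span k (Set.range β)) Φ.dualCoannihilator := by
  rw [Submodule.isCompl_iff_disjoint _ _
    (by rw [finrank_span_eq_card (linearIndependent_of_dual hφβ), hcard]), Submodule.disjoint_def]
  rintro x hx hΦ
  obtain ⟨c, rfl⟩ := (Submodule.mem_span_range_iff_exists_fun k).1 hx
  have hc (j : κ) : c j = 0 :=
    (apply_sum_smul_of_dual hφβ c j).symm.trans ((Submodule.mem_dualCoannihilator _).1 hΦ _ (hφ j))
  simp [hc]

lemma eq_sum_of_mem_of_dual {ψ : Dual k W} (hψ : ψ ∈ Φ) : ψ = ∑ j, ψ (β j) • φ j := by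
  rw [← sub_eq_zero]
  ext x
  obtain ⟨y, hy, z, hz, rfl⟩ := Submodule.mem_sup.1
    ((isCompl_span_dualCoannihilator hφβ hφ hcard).sup_eq_top ▸ Submodule.mem_top (x := x))
  obtain ⟨c, rfl⟩ := (Submodule.mem_span_range_iff_exists_fun k).1 hy
  have hz := (Submodule.mem_dualCoannihilator _).1 hz
  simp [hz _ hψ, hz _ (hφ _), hφβ, mul_comm]

end DualFamily

/-! ### Points with values in rings -/

section Points

variable {C T T' : Scheme.{u}} {W : C.Opens}

/-- The ring homomorphism `Γ(C, W) → Γ(T, ⊤)` given by a morphism `T ⟶ C` with image in `W`. -/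
def evalAt (x : T ⟶ C) (h : ⊤ ≤ x ⁻¹ᵁ W) : Γ(C, W) →+* Γ(T, ⊤) := (x.appLE W ⊤ h).hom

lemma evalAt_comp (g : T' ⟶ T) (x : T ⟶ C) (h : ⊤ ≤ x ⁻¹ᵁ W) (h' : ⊤ ≤ (g ≫ x) ⁻¹ᵁ W) :
    evalAt (g ≫ x) h' = g.appTop.hom.comp (evalAt x h) := by
  have hg := Scheme.Hom.appLE_comp_appLE g x W ⊤ ⊤ h le_top
  rw [show g.appLE ⊤ ⊤ le_top = g.appTop from g.appLE_eq_app] at hg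
  exact congr(($hg).hom).symm

lemma evalAt_map {V : C.Opens} (hVW : V ≤ W) (x : T ⟶ C) (h : ⊤ ≤ x ⁻¹ᵁ V) (f : Γ(C, W)) :
    evalAt x h (C.presheaf.map (homOfLE hVW).op f) =
      evalAt x (h.trans (x.preimage_mono hVW)) f :=
  congr(($(x.map_appLE h (homOfLE hVW).op)).hom f)

lemma evalAt_app {S : Scheme.{u}} (π : C ⟶ S) {U : S.Opens} (x : T ⟶ C)
    (h : ⊤ ≤ x ⁻¹ᵁ (π ⁻¹ᵁ U)) (h' : ⊤ ≤ (x ≫ π) ⁻¹ᵁ U) (a : Γ(S, U)) :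
    evalAt x h (π.app U a) = evalAt (x ≫ π) h' a :=
  congr(($(Scheme.Hom.comp_appLE x π U ⊤ h')).hom a).symm

lemma isUnit_evalAt_iff (a : Γ(C, W)) (x : T ⟶ C) (h : ⊤ ≤ x ⁻¹ᵁ W) :
    IsUnit (evalAt x h a) ↔ ⊤ ≤ x ⁻¹ᵁ C.basicOpen a := by
  rw [← inf_eq_left, ← Scheme.basicOpen_appLE x ⊤ W h a]
  refine ⟨fun ha ↦ T.basicOpen_of_isUnit ha, fun hx ↦ ?_⟩
  exact T.toRingedSpace.isUnit_of_isUnit_germ ⊤ _ fun y hy ↦ (T.mem_basicOpen _ y hy).1 (hx.ge hy)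

variable {B B' : Type u} [CommRing B] [CommRing B']

/-- The ring homomorphism `Γ(C, W) → B` given by a `B`-valued point of `W`. -/
def pointHom (x : Spec (.of B) ⟶ C) (h : ⊤ ≤ x ⁻¹ᵁ W) : Γ(C, W) →+* B :=
  (Scheme.ΓSpecIso (.of B)).hom.hom.comp (evalAt x h)

lemma pointHom_SpecMap_comp (f : B →+* B') (x : Spec (.of B) ⟶ C) (h : ⊤ ≤ x ⁻¹ᵁ W)
    (h' : ⊤ ≤ (Spec.map (CommRingCat.ofHom f) ≫ x) ⁻¹ᵁ W) :
    pointHom (Spec.map (CommRingCat.ofHom f) ≫ x) h' = f.comp (pointHom x h) := by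
  ext g
  rw [pointHom, evalAt_comp _ x h]
  exact congr(($(Scheme.ΓSpecIso_naturality (CommRingCat.ofHom f))).hom (evalAt x h g))

lemma evalAt_toSpecΓ_comp (x : Spec (.of Γ(T, ⊤)) ⟶ C) (h : ⊤ ≤ x ⁻¹ᵁ W)
    (h' : ⊤ ≤ (T.toSpecΓ ≫ x) ⁻¹ᵁ W) : evalAt (T.toSpecΓ ≫ x) h' = pointHom x h := by
  rw [evalAt_comp _ x h, Scheme.toSpecΓ_appTop]
  rfl

/-- The `B`-valued point of `𝔸^ι` with coordinates `u`. -/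
def specVec {ι : Type*} (u : ι → B) : ι → Γ(Spec (.of B), ⊤) :=
  fun i ↦ (Scheme.ΓSpecIso (.of B)).inv (u i)

lemma SpecMap_appTop_specVec {ι : Type*} (f : B →+* B') (u : ι → B) :
    (fun i ↦ (Spec.map (CommRingCat.ofHom f)).appTop (specVec u i)) = specVec fun i ↦ f (u i) :=
  funext fun i ↦ congr(($(Scheme.ΓSpecIso_inv_naturality (CommRingCat.ofHom f))).hom (u i)).symm

lemma toSpecΓ_appTop_specVec {ι : Type*} (u : ι → Γ(T, ⊤)) :
    (fun i ↦ T.toSpecΓ.appTop (specVec u i)) = u := by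
  ext i
  rw [Scheme.toSpecΓ_appTop]
  exact congr(($((Scheme.ΓSpecIso Γ(T, ⊤)).inv_hom_id)).hom (u i))

variable (hW : IsAffineOpen W)

/-- The `B`-valued point of `C` given by a ring homomorphism `Γ(C, W) → B`. -/
def specPoint (φ : Γ(C, W) →+* B) : Spec (.of B) ⟶ C :=
  Spec.map (CommRingCat.ofHom φ) ≫ hW.fromSpec

lemma SpecMap_comp_specPoint (f : B →+* B') (φ : Γ(C, W) →+* B) :
    Spec.map (CommRingCat.ofHom f) ≫ specPoint hW φ = specPoint hW (f.comp φ) := by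
  rw [specPoint, specPoint, CommRingCat.ofHom_comp, Spec.map_comp, Category.assoc]

lemma toSpecΓ_comp_specPoint (x : T ⟶ C) (h : ⊤ ≤ x ⁻¹ᵁ W) :
    T.toSpecΓ ≫ specPoint hW (evalAt x h) = x := by
  have hx := congr($(Scheme.Opens.toSpecΓ_SpecMap_appLE x W ⊤ h) ≫ hW.fromSpec)
  simp only [Scheme.Opens.toSpecΓ_top, Category.assoc, IsAffineOpen.toSpecΓ_fromSpec,
    Scheme.Hom.resLE_comp_ι] at hx
  have : IsIso (⊤ : T.Opens).ι := inferInstanceAs (IsIso T.topIso.hom)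
  exact (cancel_epi _).1 hx

include hW in
lemma eq_of_evalAt_eq {x y : T ⟶ C} (hx : ⊤ ≤ x ⁻¹ᵁ W) (hy : ⊤ ≤ y ⁻¹ᵁ W)
    (h : evalAt x hx = evalAt y hy) : x = y := by
  rw [← toSpecΓ_comp_specPoint hW x hx, h, toSpecΓ_comp_specPoint hW y hy]

include hW in
lemma eq_of_pointHom_eq {x y : Spec (.of B) ⟶ C} (hx : ⊤ ≤ x ⁻¹ᵁ W) (hy : ⊤ ≤ y ⁻¹ᵁ W)
    (h : pointHom x hx = pointHom y hy) : x = y :=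
  eq_of_evalAt_eq hW hx hy <| RingHom.ext fun g ↦
    (Scheme.ΓSpecIso (.of B)).commRingCatIsoToRingEquiv.injective congr($h g)

lemma le_specPoint_preimage (φ : Γ(C, W) →+* B) : ⊤ ≤ specPoint hW φ ⁻¹ᵁ W := by
  rw [specPoint, Scheme.Hom.comp_preimage, hW.fromSpec_preimage_self]
  exact le_rfl

lemma pointHom_fromSpec (h : ⊤ ≤ hW.fromSpec ⁻¹ᵁ W) :
    pointHom (B := Γ(C, W)) hW.fromSpec h = RingHom.id _ := by
  have hres : hW.fromSpec.appLE W ⊤ h = (Scheme.ΓSpecIso Γ(C, W)).inv := by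
    rw [Scheme.Hom.appLE, hW.fromSpec_app_self, Category.assoc, ← Functor.map_comp]
    exact (congrArg _ (CategoryTheory.Functor.map_id _ _)).trans (Category.comp_id _)
  rw [pointHom, evalAt, hres]
  exact congr(($((Scheme.ΓSpecIso Γ(C, W)).inv_hom_id)).hom)

lemma pointHom_specPoint (φ : Γ(C, W) →+* B) :
    pointHom (specPoint hW φ) (le_specPoint_preimage hW φ) = φ := by
  have h : ⊤ ≤ hW.fromSpec ⁻¹ᵁ W := hW.fromSpec_preimage_self.ge
  exact (pointHom_SpecMap_comp φ hW.fromSpec h _).trans (by rw [pointHom_fromSpec]; rfl)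

lemma specPoint_pointHom (x : Spec (.of B) ⟶ C) (h : ⊤ ≤ x ⁻¹ᵁ W) :
    specPoint hW (pointHom x h) = x :=
  eq_of_pointHom_eq hW (le_specPoint_preimage hW _) h (pointHom_specPoint hW _)

lemma pointHom_map {V : C.Opens} (hVW : V ≤ W) (x : Spec (.of B) ⟶ C) (h : ⊤ ≤ x ⁻¹ᵁ V)
    (f : Γ(C, W)) : pointHom x h (C.presheaf.map (homOfLE hVW).op f) =
      pointHom x (h.trans (x.preimage_mono hVW)) f :=
  congrArg _ (evalAt_map hVW x h f)

end Points

section Base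

variable {k : Type u} [Field k] {S T : Scheme.{u}}

lemma comp_scalar (g : T ⟶ S) (q : S ⟶ Spec (.of k)) (c : k) :
    g.appTop (scalar q c) = scalar (g ≫ q) c := by
  rw [scalar, scalar, Scheme.Hom.comp_appTop]
  rfl

lemma isAddTorsionFree_of_scalar [CharZero k] (q : T ⟶ Spec (.of k)) :
    IsAddTorsionFree Γ(T, ⊤) where
  nsmul_right_injective n hn a b h := by
    have hinv : scalar q (n : k)⁻¹ * (n : Γ(T, ⊤)) = 1 := by
      rw [← map_natCast (scalar q) n, ← map_mul, inv_mul_cancel₀ (Nat.cast_ne_zero.2 hn), map_one]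
    simp only [nsmul_eq_mul] at h
    rw [← one_mul a, ← one_mul b, ← hinv, mul_assoc, mul_assoc, h]

lemma exists_affineOpens_le_preimage (z : Spec (.of k) ⟶ S) :
    ∃ U : S.affineOpens, ⊤ ≤ z ⁻¹ᵁ U.1 := by
  obtain ⟨_, ⟨U, hU, rfl⟩, hxU, -⟩ := S.isBasis_affineOpens.exists_subset_of_mem_open
    (Set.mem_univ (z (IsLocalRing.closedPoint k))) isOpen_univ
  have : Subsingleton (Spec (.of k)) := inferInstanceAs (Subsingleton (PrimeSpectrum k))
  exact ⟨⟨U, hU⟩, fun y _ ↦ Subsingleton.elim (IsLocalRing.closedPoint k) y ▸ hxU⟩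

variable (p : S ⟶ Spec (.of k)) (U : S.Opens)

/-- The structure homomorphism `k → Γ(S, U)` of an open subscheme of a `k`-scheme. -/
def baseHom : k →+* Γ(S, U) :=
  (p.appLE ⊤ U le_top).hom.comp (Scheme.ΓSpecIso (.of k)).inv.hom

variable {U}

lemma evalAt_baseHom (x : T ⟶ S) (h : ⊤ ≤ x ⁻¹ᵁ U) (c : k) :
    evalAt x h (baseHom p U c) = scalar (x ≫ p) c := by
  have hx := Scheme.Hom.appLE_comp_appLE x p ⊤ U ⊤ le_top h
  rw [show (x ≫ p).appLE ⊤ ⊤ _ = (x ≫ p).appTop from (x ≫ p).appLE_eq_app] at hx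
  exact congr(($hx).hom ((Scheme.ΓSpecIso (.of k)).inv c))

lemma pointHom_baseHom {z : Spec (.of k) ⟶ S} (hz : z ≫ p = 𝟙 _) (h : ⊤ ≤ z ⁻¹ᵁ U) (c : k) :
    pointHom z h (baseHom p U c) = c := by
  rw [pointHom, RingHom.comp_apply, evalAt_baseHom, hz]
  simp [scalar]

variable [IsAlgClosed k] [LocallyOfFiniteType p]

lemma le_pointOfClosedPoint_preimage {x : S} (hx : IsClosed {x}) (hxU : x ∈ U) :
    ⊤ ≤ pointOfClosedPoint p x hx ⁻¹ᵁ U := fun y _ ↦ by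
  rwa [Scheme.Hom.mem_preimage, pointOfClosedPoint_apply]

lemma exists_point_specializes (s : S) : ∃ z : Spec (.of k) ⟶ S, z ≫ p = 𝟙 _ ∧
    ∀ V : S.Opens, ⊤ ≤ z ⁻¹ᵁ V → s ∈ V := by
  have := LocallyOfFiniteType.jacobsonSpace p
  obtain ⟨x, hxs, hx : IsClosed {x}⟩ := nonempty_inter_closedPoints
    (Set.singleton_nonempty s).closure isClosed_closure.isLocallyClosed
  refine ⟨pointOfClosedPoint p x hx, pointOfClosedPoint_comp p x hx, fun V hV ↦ ?_⟩
  obtain ⟨y⟩ : Nonempty (Spec (.of k)) := ⟨IsLocalRing.closedPoint k⟩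
  have hxV : x ∈ V := pointOfClosedPoint_apply p x hx y ▸ hV (Set.mem_univ y)
  exact (specializes_iff_mem_closure.2 hxs).mem_open V.2 hxV

lemma eq_zero_of_forall_pointHom_eq_zero [IsReduced S] {a : Γ(S, U)}
    (ha : ∀ (z : Spec (.of k) ⟶ S) (h : ⊤ ≤ z ⁻¹ᵁ U), z ≫ p = 𝟙 _ → pointHom z h a = 0) :
    a = 0 := by
  have := LocallyOfFiniteType.jacobsonSpace p
  rw [← basicOpen_eq_bot_iff, ← TopologicalSpace.Opens.coe_eq_empty]
  by_contra hne
  obtain ⟨x, hxa, hx⟩ := nonempty_inter_closedPoints (Set.nonempty_iff_ne_empty.2 hne)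
    (S.basicOpen a).2.isLocallyClosed
  have hU := le_pointOfClosedPoint_preimage p hx (S.basicOpen_le a hxa)
  refine (((isUnit_evalAt_iff a _ hU).2 (le_pointOfClosedPoint_preimage p hx hxa)).map
    (Scheme.ΓSpecIso (.of k)).hom.hom).ne_zero ?_
  exact ha _ hU (pointOfClosedPoint_comp p x hx)

end Base

/-! ### The coaction of an action on a cone -/

section SchemeCoaction

open MvPolynomial

variable {k : Type u} [Field k] {ι : Type u} {C S T : Scheme.{u}} {p : S ⟶ Spec (.of k)}
  {π : C ⟶ S} {σ : GaAction ι (π ≫ p)} (hinv : σ.act ≫ π = (𝔸(ι; C) ↘ C) ≫ π)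

include hinv in
lemma le_smul_preimage {V : S.Opens} (u : ι → Γ(T, ⊤)) {x : T ⟶ C}
    (h : ⊤ ≤ x ⁻¹ᵁ (π ⁻¹ᵁ V)) : ⊤ ≤ σ.smul u x ⁻¹ᵁ (π ⁻¹ᵁ V) := by
  rwa [← Scheme.Hom.comp_preimage, GaAction.smul, Category.assoc, hinv,
    AffineSpace.homOfVector_over_assoc, Scheme.Hom.comp_preimage]

variable [IsAffineHom π] (U : S.affineOpens)

/-- The coaction of an action of `𝔾_a^ι` on `C` over `S`, on the functions over an affine open
subset of `S`: the value of the universal vector at the universal point. -/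
def coaction : Γ(C, π ⁻¹ᵁ U.1) →+* MvPolynomial ι Γ(C, π ⁻¹ᵁ U.1) :=
  pointHom (σ.smul (specVec X) (specPoint (affine_preimage π U) MvPolynomial.C))
    (le_smul_preimage hinv _ (le_specPoint_preimage _ _))

variable {U} {B : Type u} [CommRing B]

lemma pointHom_smul_specPoint (φ : Γ(C, π ⁻¹ᵁ U.1) →+* B) (u : ι → B)
    (h : ⊤ ≤ σ.smul (specVec u) (specPoint (affine_preimage π U) φ) ⁻¹ᵁ (π ⁻¹ᵁ U.1)) :
    pointHom _ h = (eval₂Hom φ u).comp (coaction hinv U) := by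
  have hx : Spec.map (CommRingCat.ofHom (eval₂Hom φ u)) ≫
      σ.smul (specVec X) (specPoint (affine_preimage π U) MvPolynomial.C) =
        σ.smul (specVec u) (specPoint (affine_preimage π U) φ) := by
    rw [GaAction.comp_smul, SpecMap_appTop_specVec, SpecMap_comp_specPoint, eval₂Hom_comp_C]
    simp only [coe_eval₂Hom, eval₂_X]
  simp only [← hx] at h ⊢
  exact pointHom_SpecMap_comp _ _ _ _

lemma evalAt_smul (u : ι → Γ(T, ⊤)) (x : T ⟶ C) (h : ⊤ ≤ x ⁻¹ᵁ (π ⁻¹ᵁ U.1))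
    (h' : ⊤ ≤ σ.smul u x ⁻¹ᵁ (π ⁻¹ᵁ U.1)) :
    evalAt (σ.smul u x) h' = (eval₂Hom (evalAt x h) u).comp (coaction hinv U) := by
  have hx : T.toSpecΓ ≫ σ.smul (specVec u) (specPoint (affine_preimage π U) (evalAt x h)) =
      σ.smul u x := by
    rw [GaAction.comp_smul, toSpecΓ_appTop_specVec, toSpecΓ_comp_specPoint]
  simp only [← hx] at h' ⊢
  rw [evalAt_toSpecΓ_comp _ (le_smul_preimage hinv _ (le_specPoint_preimage _ _)),
    pointHom_smul_specPoint]

lemma pointHom_smul (u : ι → B) (x : Spec (.of B) ⟶ C) (h : ⊤ ≤ x ⁻¹ᵁ (π ⁻¹ᵁ U.1))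
    (h' : ⊤ ≤ σ.smul (specVec u) x ⁻¹ᵁ (π ⁻¹ᵁ U.1)) :
    pointHom (σ.smul (specVec u) x) h' =
      (eval₂Hom (pointHom x h) u).comp (coaction hinv U) := by
  have hx := pointHom_smul_specPoint hinv (pointHom x h) u
    (le_smul_preimage hinv _ (le_specPoint_preimage _ _))
  simpa only [specPoint_pointHom] using hx

lemma coaction_map {V : S.affineOpens} (hVU : V.1 ≤ U.1) (g : Γ(C, π ⁻¹ᵁ U.1)) :
    coaction hinv V (C.presheaf.map (homOfLE (π.preimage_mono hVU)).op g) =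
      map (C.presheaf.map (homOfLE (π.preimage_mono hVU)).op).hom (coaction hinv U g) := by
  have hC := le_specPoint_preimage (affine_preimage π V)
    (MvPolynomial.C : Γ(C, π ⁻¹ᵁ V.1) →+* MvPolynomial ι Γ(C, π ⁻¹ᵁ V.1))
  have hC' := hC.trans (Scheme.Hom.preimage_mono _ (π.preimage_mono hVU))
  have hres : pointHom (specPoint (affine_preimage π V) MvPolynomial.C) hC' =
      MvPolynomial.C.comp (C.presheaf.map (homOfLE (π.preimage_mono hVU)).op).hom := by
    ext1 f
    rw [← pointHom_map (π.preimage_mono hVU) _ hC, pointHom_specPoint]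
    rfl
  rw [coaction, pointHom_map, pointHom_smul hinv _ _ hC', hres]
  exact (eval₂_map _ X MvPolynomial.C _).symm.trans (eval₂_eta _)

variable (G : ConeGrading π)

lemma le_gm_preimage {V : S.Opens} (t : Γ(T, ⊤)ˣ) {x : T ⟶ C} (h : ⊤ ≤ x ⁻¹ᵁ (π ⁻¹ᵁ V)) :
    ⊤ ≤ G.gm t x ⁻¹ᵁ (π ⁻¹ᵁ V) := by
  rwa [← Scheme.Hom.comp_preimage, G.gm_comp]

lemma evalAt_gm (t : Γ(T, ⊤)ˣ) (x : T ⟶ C) (h : ⊤ ≤ x ⁻¹ᵁ (π ⁻¹ᵁ U.1))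
    (h' : ⊤ ≤ G.gm t x ⁻¹ᵁ (π ⁻¹ᵁ U.1)) :
    evalAt (G.gm t x) h' = twist (G.piece U) (evalAt x h) t := by
  refine graded_hom_ext (G.piece U) fun n f hf ↦ ?_
  rw [twist_of_mem _ _ _ hf]
  have hle : (x ≫ π) ⁻¹ᵁ U.1 ≤ G.gm t x ⁻¹ᵁ (π ⁻¹ᵁ U.1) := (le_gm_preimage G t h).trans' le_top
  let res := T.presheaf.map (homOfLE (show ⊤ ≤ (x ≫ π) ⁻¹ᵁ U.1 from h)).op
  have hgm := congr(res $(G.gm_appLE t x U hle n f hf))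
  have ht : res (T.presheaf.map (homOfLE le_top).op (t : Γ(T, ⊤))) = t := by
    rw [← CommRingCat.comp_apply, ← T.presheaf.map_comp]
    exact congr(($(T.presheaf.map_id _)).hom (t : Γ(T, ⊤)))
  rw [map_mul, map_pow, ht] at hgm
  refine (congr(($((G.gm t x).appLE_map hle _)).hom f)).symm.trans (hgm.trans ?_)
  exact congr(_ * ($(x.appLE_map (U := π ⁻¹ᵁ U.1) (V := (x ≫ π) ⁻¹ᵁ U.1) le_rfl _)).hom f)

/-- The `B`-valued point of `𝔾_m` given by a unit of `B`. -/
def specUnit (t : Bˣ) : Γ(Spec (.of B), ⊤)ˣ :=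
  Units.map (Scheme.ΓSpecIso (.of B)).inv.hom.toMonoidHom t

lemma pointHom_gm (t : Bˣ) (x : Spec (.of B) ⟶ C) (h : ⊤ ≤ x ⁻¹ᵁ (π ⁻¹ᵁ U.1))
    (h' : ⊤ ≤ G.gm (specUnit t) x ⁻¹ᵁ (π ⁻¹ᵁ U.1)) :
    pointHom _ h' = twist (G.piece U) (pointHom x h) (t : B) := by
  rw [pointHom, evalAt_gm G _ x h, comp_twist]
  exact congrArg _ congr(($((Scheme.ΓSpecIso (.of B)).inv_hom_id)).hom (t : B))

lemma coeff_zero_coaction (g : Γ(C, π ⁻¹ᵁ U.1)) : coeff 0 (coaction hinv U g) = g := by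
  have hx : σ.smul (specVec 0) (specPoint (affine_preimage π U) (RingHom.id _)) = _ :=
    (congrArg (σ.smul · _) (funext fun _ ↦ map_zero _)).trans (σ.zero_smul _)
  have h := pointHom_smul_specPoint hinv (RingHom.id _) 0
    (le_smul_preimage hinv _ (le_specPoint_preimage (affine_preimage π U) _))
  simp only [hx, pointHom_specPoint] at h
  simpa [constantCoeff_eq] using congr($h g).symm

lemma eval₂_add_coaction (φ : Γ(C, π ⁻¹ᵁ U.1) →+* B) (u v : ι → B) :
    (eval₂Hom φ (u + v)).comp (coaction hinv U) =
      (eval₂Hom ((eval₂Hom φ v).comp (coaction hinv U)) u).comp (coaction hinv U) := by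
  have hφ := le_specPoint_preimage (affine_preimage π U) φ
  have hx : σ.smul (specVec (u + v)) (specPoint (affine_preimage π U) φ) = _ :=
    (congrArg (σ.smul · _) (funext fun _ ↦ map_add _ _ _)).trans (σ.add_smul _ _ _)
  have h := pointHom_smul_specPoint hinv φ (u + v) (le_smul_preimage hinv _ hφ)
  simp only [hx] at h
  rw [← h, ← pointHom_smul_specPoint hinv φ v (le_smul_preimage hinv _ hφ)]
  exact pointHom_smul hinv u _ _ _

lemma twist_coaction {w : ℕ} (hsemi : IsSemidirect G σ w) (t : Bˣ)
    (φ : Γ(C, π ⁻¹ᵁ U.1) →+* B) (u : ι → B) :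
    twist (G.piece U) ((eval₂Hom φ u).comp (coaction hinv U)) (t : B) =
      (eval₂Hom (twist (G.piece U) φ (t : B)) fun i ↦ (t : B) ^ w * u i).comp
        (coaction hinv U) := by
  have hφ := le_specPoint_preimage (affine_preimage π U) φ
  have hx : G.gm (specUnit t) (σ.smul (specVec u) (specPoint (affine_preimage π U) φ)) =
      σ.smul (specVec fun i ↦ (t : B) ^ w * u i) (G.gm (specUnit t) (specPoint _ φ)) :=
    (hsemi _ (specUnit t) _ _).trans <| congrArg (σ.smul · _) <| funext fun i ↦ by
      simp only [specVec, map_mul, map_pow]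
      rfl
  have h := pointHom_gm G t _ (le_smul_preimage hinv (specVec u) hφ)
    (le_gm_preimage G _ (le_smul_preimage hinv _ hφ))
  simp only [hx] at h
  rw [pointHom_smul hinv _ _ (le_gm_preimage G _ hφ), pointHom_gm G t _ hφ, pointHom_specPoint,
    pointHom_smul_specPoint] at h
  exact h.symm

lemma isGradedCoaction {w : ℕ} (hsemi : IsSemidirect G σ w) :
    IsGradedCoaction (G.piece U) w (coaction hinv U) where
  coeff_zero := coeff_zero_coaction hinv
  add φ u v g := congr($(eval₂_add_coaction hinv φ u v) g)
  twist t φ u g := congr($(twist_coaction hinv G hsemi t φ u) g)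

end SchemeCoaction

/-! ### Differentials along the zero section -/

section ZeroSection

variable {C S T : Scheme.{u}} {π : C ⟶ S} (G : ConeGrading π)

variable {U : S.affineOpens}

lemma zeroRing_map {V : S.affineOpens} (hVU : V.1 ≤ U.1) (g : Γ(C, π ⁻¹ᵁ U.1)) :
    G.zeroRing V (C.presheaf.map (homOfLE (π.preimage_mono hVU)).op g) =
      S.presheaf.map (homOfLE hVU).op (G.zeroRing U g) :=
  congr(($(G.zero_compat V U hVU)).hom g)

variable [IsAffineHom π]

lemma le_zeroSection_preimage {V : S.Opens} {s : T ⟶ S} (h : ⊤ ≤ s ⁻¹ᵁ V) :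
    ⊤ ≤ (s ≫ G.zeroSection) ⁻¹ᵁ (π ⁻¹ᵁ V) := by
  rwa [← Scheme.Hom.comp_preimage, Category.assoc, G.zeroSection_comp, Category.comp_id]

lemma evalAt_comp_zeroSection (s : T ⟶ S) (h : ⊤ ≤ s ⁻¹ᵁ U.1)
    (h' : ⊤ ≤ (s ≫ G.zeroSection) ⁻¹ᵁ (π ⁻¹ᵁ U.1)) :
    evalAt (s ≫ G.zeroSection) h' = (evalAt s h).comp (G.zeroRing U) := by
  have hU : U.1 ≤ G.zeroSection ⁻¹ᵁ (π ⁻¹ᵁ U.1) := by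
    rw [← Scheme.Hom.comp_preimage, G.zeroSection_comp, Scheme.Hom.id_preimage]
  have hzero : G.zeroSection.appLE (π ⁻¹ᵁ U.1) U.1 hU = CommRingCat.ofHom (G.zeroRing U) :=
    (relHom_appLE π (𝟙 S) G.zero_compat U hU).trans (Category.comp_id _)
  have hs := Scheme.Hom.appLE_comp_appLE s G.zeroSection (π ⁻¹ᵁ U.1) U.1 ⊤ hU h
  rw [hzero] at hs
  exact congr(($hs).hom).symm

end ZeroSection

section DerivAtZero

open MvPolynomial

variable {k : Type u} [Field k] {ι : Type u} {C S : Scheme.{u}} {p : S ⟶ Spec (.of k)}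
  {π : C ⟶ S} [IsAffineHom π] (G : ConeGrading π) {σ : GaAction ι (π ≫ p)}
  (hinv : σ.act ≫ π = (𝔸(ι; C) ↘ C) ≫ π) {U : S.affineOpens}

/-- The derivative of a function on the cone along the `l`-th fundamental vector field, restricted
to the zero section. -/
def derivAtZero (l : ι) : Γ(C, π ⁻¹ᵁ U.1) →+ Γ(S, U.1) :=
  (G.zeroRing U).toAddMonoidHom.comp (vectorField (coaction hinv U) l)

lemma derivAtZero_apply (l : ι) (g : Γ(C, π ⁻¹ᵁ U.1)) :
    derivAtZero G hinv l g = G.zeroRing U (vectorField (coaction hinv U) l g) := rfl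

lemma derivAtZero_map {V : S.affineOpens} (hVU : V.1 ≤ U.1) (l : ι) (g : Γ(C, π ⁻¹ᵁ U.1)) :
    derivAtZero G hinv l (C.presheaf.map (homOfLE (π.preimage_mono hVU)).op g) =
      S.presheaf.map (homOfLE hVU).op (derivAtZero G hinv l g) := by
  rw [derivAtZero_apply, vectorField_apply, coaction_map hinv hVU, coeff_map]
  exact zeroRing_map G hVU _

variable {G} {w : ℕ} (hsemi : IsSemidirect G σ w)
include hsemi

lemma app_derivAtZero (l : ι) {f : Γ(C, π ⁻¹ᵁ U.1)} (hf : f ∈ G.piece U w) :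
    π.app U.1 (derivAtZero G hinv l f) = vectorField (coaction hinv U) l f :=
  (G.app_zeroRing U _).trans <|
    DirectSum.decompose_of_mem_same _ ((isGradedCoaction hinv G hsemi).vectorField_mem hf l)

lemma derivAtZero_app_mul (hw : 0 < w) (l : ι) (a : Γ(S, U.1)) (g : Γ(C, π ⁻¹ᵁ U.1)) :
    derivAtZero G hinv l (π.app U.1 a * g) = a * derivAtZero G hinv l g := by
  rw [derivAtZero_apply, vectorField_apply, map_mul,
    (isGradedCoaction hinv G hsemi).apply_of_mem_zero hw (G.app_mem_zero U a), coeff_C_mul,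
    map_mul, G.zeroRing_app, derivAtZero_apply, vectorField_apply]

lemma derivAtZero_decompose (l : ι) (g : Γ(C, π ⁻¹ᵁ U.1)) :
    derivAtZero G hinv l (DirectSum.decompose (G.piece U) g w) = derivAtZero G hinv l g := by
  induction g using DirectSum.Decomposition.inductionOn (G.piece U) with
  | zero => simp
  | @homogeneous n g =>
    rcases eq_or_ne n w with rfl | hn
    · rw [DirectSum.decompose_of_mem_same _ g.2]
    · rw [DirectSum.decompose_of_mem_ne _ g.2 hn, map_zero]
      apply G.injective U
      rw [map_zero]
      refine Eq.trans ?_ (G.app_zeroRing U _).symm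
      exact ((isGradedCoaction hinv G hsemi).decompose_coeff g.2 _ (by simpa using hn.symm)).symm
  | add g g' hg hg' =>
    rw [DirectSum.decompose_add, DirectSum.add_apply, AddSubgroup.coe_add, map_add, hg, hg',
      map_add]

end DerivAtZero

section Stab

open MvPolynomial

variable {k : Type u} [Field k] {ι : Type u} {C S : Scheme.{u}} {p : S ⟶ Spec (.of k)}
  {π : C ⟶ S} [IsAffineHom π] (G : ConeGrading π) {σ : GaAction ι (π ≫ p)}
  (hinv : σ.act ≫ π = (𝔸(ι; C) ↘ C) ≫ π) {U : S.affineOpens}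

lemma smul_specVec_eq_iff {B : Type u} [CommRing B] (u : ι → B) {x : Spec (.of B) ⟶ C}
    (h : ⊤ ≤ x ⁻¹ᵁ (π ⁻¹ᵁ U.1)) : σ.smul (specVec u) x = x ↔
      ∀ g, eval₂ (pointHom x h) u (coaction hinv U g) = pointHom x h g := by
  have hu := pointHom_smul hinv u x h (le_smul_preimage hinv _ h)
  refine ⟨fun hx g ↦ ?_, fun hg ↦ ?_⟩
  · simp only [hx] at hu
    exact congr($hu g).symm
  · exact eq_of_pointHom_eq (affine_preimage π U) _ h (hu.trans (RingHom.ext hg))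

variable [Fintype ι]

/-- The differential at the origin of `𝔾_a^ι` of the function `u ↦ g (u.z)`, for a `k`-point `z` of
the zero section. -/
def orbitDifferential (z : Spec (.of k) ⟶ S) (h : ⊤ ≤ z ⁻¹ᵁ U.1) (g : Γ(C, π ⁻¹ᵁ U.1)) :
    Module.Dual k (ι → k) :=
  Fintype.linearCombination k fun l ↦ pointHom z h (derivAtZero G hinv l g)

lemma orbitDifferential_apply (z : Spec (.of k) ⟶ S) (h : ⊤ ≤ z ⁻¹ᵁ U.1) (g : Γ(C, π ⁻¹ᵁ U.1))
    (ξ : ι → k) : orbitDifferential G hinv z h g ξ =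
      ∑ l, ξ l * pointHom z h (derivAtZero G hinv l g) := rfl

lemma orbitDifferential_single [DecidableEq ι] (z : Spec (.of k) ⟶ S) (h : ⊤ ≤ z ⁻¹ᵁ U.1)
    (g : Γ(C, π ⁻¹ᵁ U.1)) (l : ι) : orbitDifferential G hinv z h g (Pi.single l 1) =
      pointHom z h (derivAtZero G hinv l g) := by
  rw [orbitDifferential, Fintype.linearCombination_apply_single, one_smul]

lemma mem_stab_iff (z : Spec (.of k) ⟶ S) (h : ⊤ ≤ z ⁻¹ᵁ U.1) (ξ : ι → k) :
    ξ ∈ σ.stab (z ≫ G.zeroSection) ↔ ∀ g, orbitDifferential G hinv z h g ξ = 0 := by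
  let c := algebraMap k (DualNumber k)
  have hx := le_zeroSection_preimage G h
  have hεx : ⊤ ≤ (GaAction.dualBase k ≫ z ≫ G.zeroSection) ⁻¹ᵁ (π ⁻¹ᵁ U.1) :=
    fun y _ ↦ hx (Set.mem_univ (GaAction.dualBase k y))
  have hpt : pointHom _ hεx = (c.comp (pointHom z h)).comp (G.zeroRing U) := by
    refine (pointHom_SpecMap_comp _ _ hx hεx).trans ?_
    rw [pointHom, evalAt_comp_zeroSection G z h]
    rfl
  refine (smul_specVec_eq_iff hinv (fun i ↦ (TrivSqZeroExt.inr (ξ i) : DualNumber k)) hεx).trans ?_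
  refine forall_congr' fun g ↦ ?_
  rw [eval₂_of_mul_eq_zero _ fun i j ↦ TrivSqZeroExt.inr_mul_inr _ _ _,
    coeff_zero_coaction, add_eq_left, hpt, orbitDifferential_apply]
  simp only [RingHom.comp_apply, c, TrivSqZeroExt.algebraMap_eq_inl, TrivSqZeroExt.inr_mul_inl,
    ← TrivSqZeroExt.inr_sum]
  exact TrivSqZeroExt.inr_injective.eq_iff' (TrivSqZeroExt.inr_zero _)

lemma stab_eq_dualCoannihilator (z : Spec (.of k) ⟶ S) (h : ⊤ ≤ z ⁻¹ᵁ U.1) :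
    σ.stab (z ≫ G.zeroSection) =
      (Submodule.span k (Set.range (orbitDifferential G hinv z h))).dualCoannihilator := by
  ext ξ
  rw [mem_stab_iff G hinv z h, ← SetLike.mem_coe, Submodule.coe_dualCoannihilator_span,
    Set.mem_ofPred_eq, Set.forall_mem_range]

end Stab

/-! ### Dual frames -/

section DerivAlong

variable {k : Type u} [Field k] {ι : Type u} [Fintype ι] {C S T : Scheme.{u}}
  {p : S ⟶ Spec (.of k)} {π : C ⟶ S} [IsAffineHom π] (G : ConeGrading π) {σ : GaAction ι (π ≫ p)}
  (hinv : σ.act ≫ π = (𝔸(ι; C) ↘ C) ≫ π) {U : S.affineOpens}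

/-- The derivative of a function on the cone in the direction `ξ ∈ 𝔲`, restricted to the zero
section. -/
def derivAlong (ξ : ι → k) : Γ(C, π ⁻¹ᵁ U.1) →+ Γ(S, U.1) :=
  ∑ l, (AddMonoidHom.mulLeft (baseHom p U.1 (ξ l))).comp (derivAtZero G hinv l)

lemma derivAlong_apply (ξ : ι → k) (g : Γ(C, π ⁻¹ᵁ U.1)) :
    derivAlong G hinv ξ g = ∑ l, baseHom p U.1 (ξ l) * derivAtZero G hinv l g := by
  simp [derivAlong]

lemma evalAt_derivAlong (y : T ⟶ S) (h : ⊤ ≤ y ⁻¹ᵁ U.1) (ξ : ι → k) (g : Γ(C, π ⁻¹ᵁ U.1)) :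
    evalAt y h (derivAlong G hinv ξ g) =
      ∑ l, scalar (y ≫ p) (ξ l) * evalAt y h (derivAtZero G hinv l g) := by
  simp only [derivAlong_apply, map_sum, map_mul, evalAt_baseHom]

lemma pointHom_derivAlong {z : Spec (.of k) ⟶ S} (hz : z ≫ p = 𝟙 _) (h : ⊤ ≤ z ⁻¹ᵁ U.1)
    (ξ : ι → k) (g : Γ(C, π ⁻¹ᵁ U.1)) :
    pointHom z h (derivAlong G hinv ξ g) = orbitDifferential G hinv z h g ξ := by
  simp only [derivAlong_apply, map_sum, map_mul, pointHom_baseHom p hz, orbitDifferential_apply]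

lemma baseHom_map {V V' : S.Opens} (hV : V' ≤ V) (c : k) :
    S.presheaf.map (homOfLE hV).op (baseHom p V c) = baseHom p V' c :=
  congr(($(p.appLE_map (U := ⊤) le_top (homOfLE hV).op)).hom _)

lemma derivAlong_map {V : S.affineOpens} (hVU : V.1 ≤ U.1) (ξ : ι → k) (g : Γ(C, π ⁻¹ᵁ U.1)) :
    derivAlong G hinv ξ (C.presheaf.map (homOfLE (π.preimage_mono hVU)).op g) =
      S.presheaf.map (homOfLE hVU).op (derivAlong G hinv ξ g) := by
  simp only [derivAlong_apply, map_sum, map_mul, derivAtZero_map G hinv hVU, baseHom_map]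

variable {G} in
lemma derivAlong_decompose_sum {w : ℕ} (hsemi : IsSemidirect G σ w) (hw : 0 < w) {κ : Type*}
    [Fintype κ] (ξ : ι → k) (a : κ → Γ(S, U.1)) (m : κ → Γ(C, π ⁻¹ᵁ U.1)) :
    derivAlong G hinv ξ (DirectSum.decompose (G.piece U) (∑ i, π.app U.1 (a i) * m i) w) =
      ∑ i, a i * derivAlong G hinv ξ (m i) := by
  simp only [derivAlong_apply, derivAtZero_decompose hinv hsemi, map_sum,
    derivAtZero_app_mul hinv hsemi hw, Finset.mul_sum]
  rw [Finset.sum_comm]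
  exact Finset.sum_congr rfl fun i _ ↦ Finset.sum_congr rfl fun l _ ↦ mul_left_comm _ _ _

end DerivAlong

section DualFrame

open Module

variable {k : Type u} [Field k] {ι : Type u} [Fintype ι] {C S : Scheme.{u}}
  {p : S ⟶ Spec (.of k)} {π : C ⟶ S} [IsAffineHom π] (G : ConeGrading π) {σ : GaAction ι (π ≫ p)}
  (hinv : σ.act ≫ π = (𝔸(ι; C) ↘ C) ≫ π) {U V : S.affineOpens}

lemma exists_dual_orbitDifferential (z : Spec (.of k) ⟶ S) (h : ⊤ ≤ z ⁻¹ᵁ U.1) :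
    ∃ (b : ℕ) (m : ULift.{u} (Fin b) → Γ(C, π ⁻¹ᵁ U.1)) (β : ULift.{u} (Fin b) → ι → k),
      b + finrank k (σ.stab (z ≫ G.zeroSection)) = Fintype.card ι ∧
      ∀ i j, orbitDifferential G hinv z h (m j) (β i) = if i = j then 1 else 0 := by
  obtain ⟨φ, hφ, -, hli⟩ := Submodule.exists_fun_fin_finrank_span_eq k
    (Set.range (orbitDifferential G hinv z h))
  choose m hm using hφ
  obtain ⟨β, hβ⟩ := exists_dual_family (hli.comp ULift.down.{u} ULift.down_injective)
  refine ⟨_, fun j ↦ m j.down, β, ?_, fun i j ↦ by rw [hm]; exact hβ i j⟩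
  rw [stab_eq_dualCoannihilator G hinv z h, Subspace.finrank_add_finrank_dualCoannihilator_eq,
    finrank_fintype_fun_eq_card]

variable {κ : Type u} [Fintype κ] [DecidableEq κ]

/-- The matrix of the pairing between directions `β i ∈ 𝔲` and functions `m j` on the cone. -/
def derivMatrix (β : κ → ι → k) (m : κ → Γ(C, π ⁻¹ᵁ U.1)) : Matrix κ κ Γ(S, U.1) :=
  .of fun i j ↦ derivAlong G hinv (β i) (m j)

lemma exists_isUnit_det_derivMatrix {z : Spec (.of k) ⟶ S} (hz : z ≫ p = 𝟙 _)
    (h : ⊤ ≤ z ⁻¹ᵁ U.1) {m : κ → Γ(C, π ⁻¹ᵁ U.1)} {β : κ → ι → k}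
    (hmβ : ∀ i j, orbitDifferential G hinv z h (m j) (β i) = if i = j then 1 else 0) :
    ∃ (V : S.affineOpens) (m' : κ → Γ(C, π ⁻¹ᵁ V.1)),
      ⊤ ≤ z ⁻¹ᵁ V.1 ∧ IsUnit (derivMatrix G hinv β m').det := by
  let a := (derivMatrix G hinv β m).det
  have ha : pointHom z h a = 1 := by
    rw [RingHom.map_det, ← Matrix.det_one (n := κ)]
    congr 1
    ext i j
    exact (pointHom_derivAlong G hinv hz h _ _).trans ((hmβ i j).trans Matrix.one_apply.symm)
  let V : S.affineOpens := S.affineBasicOpen a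
  have hVU : V.1 ≤ U.1 := S.basicOpen_le a
  refine ⟨V, fun j ↦ C.presheaf.map (homOfLE (π.preimage_mono hVU)).op (m j), ?_, ?_⟩
  · refine (isUnit_evalAt_iff a z h).1 ?_
    refine (isUnit_map_iff (Scheme.ΓSpecIso (.of k)).commRingCatIsoToRingEquiv _).1 ?_
    exact (show pointHom z h a = 1 from ha) ▸ isUnit_one
  · have hdet : (derivMatrix G hinv β fun j ↦
        C.presheaf.map (homOfLE (π.preimage_mono hVU)).op (m j)).det =
        S.presheaf.map (homOfLE hVU).op a := by
      refine Eq.trans ?_ (RingHom.map_det (S.presheaf.map (homOfLE hVU).op).hom _).symm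
      congr 1
      ext i j
      exact derivAlong_map G hinv hVU _ _
    rw [hdet]
    exact S.toRingedSpace.isUnit_res_basicOpen a

variable {G}

lemma exists_dual_of_isUnit_det {w : ℕ} (hsemi : IsSemidirect G σ w) (hw : 0 < w)
    {m : κ → Γ(C, π ⁻¹ᵁ V.1)} {β : κ → ι → k} (hm : IsUnit (derivMatrix G hinv β m).det) :
    ∃ f : κ → Γ(C, π ⁻¹ᵁ V.1), (∀ j, f j ∈ G.piece V w) ∧
      ∀ i j, derivAlong G hinv (β i) (f j) = if i = j then 1 else 0 := by
  let P := derivMatrix G hinv β m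
  refine ⟨fun j ↦ DirectSum.decompose (G.piece V) (∑ i, π.app V.1 (P⁻¹ i j) * m i) w,
    fun j ↦ SetLike.coe_mem _, fun i j ↦ ?_⟩
  calc _ = ∑ l, P⁻¹ l j * P i l := derivAlong_decompose_sum hinv hsemi hw _ _ _
    _ = (P * P⁻¹) i j := by simp only [Matrix.mul_apply, mul_comm]
    _ = if i = j then 1 else 0 := by rw [Matrix.mul_nonsing_inv P hm, Matrix.one_apply]

variable (G) in
/-- Functions `f j` of degree `w` on the cone over `V`, dual to the directions `β j ∈ 𝔲`, whose
differentials along the orbits of the zero section span those of all functions. -/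
structure IsDualFrame (w : ℕ) (β : κ → ι → k) (f : κ → Γ(C, π ⁻¹ᵁ V.1)) : Prop where
  mem (j : κ) : f j ∈ G.piece V w
  pairing (i j : κ) : derivAlong G hinv (β i) (f j) = if i = j then 1 else 0
  relation (l : ι) (g : Γ(C, π ⁻¹ᵁ V.1)) :
    derivAtZero G hinv l g = ∑ j, derivAtZero G hinv l (f j) * derivAlong G hinv (β j) g

section Pairing

variable {f : κ → Γ(C, π ⁻¹ᵁ V.1)} {β : κ → ι → k}
  (hf : ∀ i j, derivAlong G hinv (β i) (f j) = if i = j then 1 else 0)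
include hf

omit [Fintype κ] in
lemma orbitDifferential_dual {z : Spec (.of k) ⟶ S} (hz : z ≫ p = 𝟙 _) (h : ⊤ ≤ z ⁻¹ᵁ V.1)
    (i j : κ) : orbitDifferential G hinv z h (f j) (β i) = if i = j then 1 else 0 := by
  rw [← pointHom_derivAlong G hinv hz h, hf, apply_ite (pointHom z h), map_one, map_zero]

lemma isCompl_span_stab {z : Spec (.of k) ⟶ S} (hz : z ≫ p = 𝟙 _) (h : ⊤ ≤ z ⁻¹ᵁ V.1)
    (hcard : Fintype.card κ + finrank k (σ.stab (z ≫ G.zeroSection)) = Fintype.card ι) :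
    IsCompl (Submodule.span k (Set.range β)) (σ.stab (z ≫ G.zeroSection)) := by
  rw [stab_eq_dualCoannihilator G hinv z h] at hcard ⊢
  exact isCompl_span_dualCoannihilator (orbitDifferential_dual hinv hf hz h)
    (fun j ↦ Submodule.subset_span ⟨f j, rfl⟩) (by rw [hcard, finrank_fintype_fun_eq_card])

/-- At every `k`-point the differentials of the `f j` form a basis of the span of all differentials,
as their number is the dimension of that span; since `S` is reduced, the resulting relation
holds identically. -/
lemma derivAtZero_eq_sum [IsAlgClosed k] [LocallyOfFiniteType p] [IsReduced S]
    (hcard : ∀ z : Spec (.of k) ⟶ S, z ≫ p = 𝟙 _ →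
      Fintype.card κ + finrank k (σ.stab (z ≫ G.zeroSection)) = Fintype.card ι)
    (l : ι) (g : Γ(C, π ⁻¹ᵁ V.1)) :
    derivAtZero G hinv l g = ∑ j, derivAtZero G hinv l (f j) * derivAlong G hinv (β j) g := by
  classical
  rw [← sub_eq_zero]
  refine eq_zero_of_forall_pointHom_eq_zero p fun z h hz ↦ ?_
  have hspan := eq_sum_of_mem_of_dual (orbitDifferential_dual hinv hf hz h)
    (fun j ↦ Submodule.subset_span (Set.mem_range_self (f j)))
    (by rw [← stab_eq_dualCoannihilator, hcard z hz, finrank_fintype_fun_eq_card])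
    (Submodule.subset_span (Set.mem_range_self g))
  have hl := LinearMap.congr_fun hspan (Pi.single l 1)
  rw [LinearMap.sum_apply, orbitDifferential_single] at hl
  rw [map_sub, hl, map_sum, sub_eq_zero]
  refine Finset.sum_congr rfl fun j _ ↦ ?_
  rw [LinearMap.smul_apply, orbitDifferential_single, smul_eq_mul, map_mul, mul_comm,
    pointHom_derivAlong G hinv hz h]

end Pairing

lemma exists_isDualFrame [IsAlgClosed k] [LocallyOfFiniteType p] [IsReduced S] {w d : ℕ}
    (hw : 0 < w) (hsemi : IsSemidirect G σ w)
    (hstab : ∀ z : Spec (.of k) ⟶ S, z ≫ p = 𝟙 _ → finrank k (σ.stab (z ≫ G.zeroSection)) = d)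
    (s : S) : ∃ V : S.affineOpens, s ∈ V.1 ∧
      ∃ (b : ℕ) (β : ULift.{u} (Fin b) → ι → k) (f : ULift.{u} (Fin b) → Γ(C, π ⁻¹ᵁ V.1)),
        LinearIndependent k β ∧
        (∀ z : Spec (.of k) ⟶ S, z ≫ p = 𝟙 _ → z ⁻¹ᵁ V.1 = ⊤ →
          IsCompl (Submodule.span k (Set.range β)) (σ.stab (z ≫ G.zeroSection))) ∧
        IsDualFrame G hinv w β f := by
  obtain ⟨z, hz, hzs⟩ := exists_point_specializes p s
  obtain ⟨U, h⟩ := exists_affineOpens_le_preimage z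
  obtain ⟨b, m, β, hb, hmβ⟩ := exists_dual_orbitDifferential G hinv z h
  obtain ⟨V, m', hV, hdet⟩ := exists_isUnit_det_derivMatrix G hinv hz h hmβ
  obtain ⟨f, hmem, hf⟩ := exists_dual_of_isUnit_det hinv hsemi hw hdet
  have hcard (y : Spec (.of k) ⟶ S) (hy : y ≫ p = 𝟙 _) : Fintype.card (ULift.{u} (Fin b)) +
      finrank k (σ.stab (y ≫ G.zeroSection)) = Fintype.card ι := by
    rw [hstab y hy, ← hstab z hz, Fintype.card_ulift, Fintype.card_fin, hb]
  exact ⟨V, hzs V.1 hV, b, β, f, linearIndependent_of_dual (orbitDifferential_dual hinv hf hz hV),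
    fun y hy hyV ↦ isCompl_span_stab hinv hf hy hyV.ge (hcard y hy),
    hmem, hf, derivAtZero_eq_sum hinv hf hcard⟩

end DualFrame

/-! ### Orbits of the zero section -/

section Sweep

variable {k : Type u} [Field k] {ι κ : Type u} [Fintype κ] {C S T Z : Scheme.{u}}

namespace GaAction

lemma comp_lin (g : T ⟶ Z) (q : Z ⟶ Spec (.of k)) (β : κ → ι → k) (c : κ → Γ(Z, ⊤)) (l : ι) :
    g.appTop (lin q β c l) = lin (g ≫ q) β (fun j ↦ g.appTop (c j)) l := by
  simp only [lin, map_sum, map_mul, comp_scalar]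

variable {p : C ⟶ Spec (.of k)} (σ : GaAction ι p)

lemma comp_sweep (i : Z ⟶ C) (y : T ⟶ 𝔸(ι; Z)) : y ≫ σ.sweep i =
    σ.smul (fun l ↦ y.appTop (AffineSpace.coord Z l)) ((y ≫ (𝔸(ι; Z) ↘ Z)) ≫ i) := by
  rw [sweep, smul, ← Category.assoc]
  congr 1
  refine AffineSpace.hom_ext (by simp) fun l ↦ ?_
  rw [Scheme.Hom.comp_appTop, CommRingCat.comp_apply, AffineSpace.map_appTop_coord,
    AffineSpace.homOfVector_appTop_coord]

lemma comp_subSweep (β : κ → ι → k) (i : Z ⟶ C) (y : T ⟶ 𝔸(κ; Z)) : y ≫ σ.subSweep β i =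
    σ.smul (lin ((y ≫ (𝔸(κ; Z) ↘ Z)) ≫ i ≫ p) β fun j ↦ y.appTop (AffineSpace.coord Z j))
      ((y ≫ (𝔸(κ; Z) ↘ Z)) ≫ i) := by
  rw [subSweep, ← Category.assoc, comp_sweep]
  congr 1
  · ext l
    rw [Scheme.Hom.comp_appTop, CommRingCat.comp_apply, subgroupHom,
      AffineSpace.homOfVector_appTop_coord, comp_lin]
    simp only [Category.assoc]
  · rw [subgroupHom, Category.assoc y, AffineSpace.homOfVector_over]

end GaAction

variable {p : S ⟶ Spec (.of k)} {π : C ⟶ S} {σ : GaAction ι (π ≫ p)}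
  (hinv : σ.act ≫ π = (𝔸(ι; C) ↘ C) ≫ π) {z : Z ⟶ C}
include hinv

lemma sweep_comp : σ.sweep z ≫ π = (𝔸(ι; Z) ↘ Z) ≫ z ≫ π := by
  rw [GaAction.sweep, Category.assoc, hinv, AffineSpace.map_over_assoc]

lemma subSweep_comp (β : κ → ι → k) : σ.subSweep β z ≫ π = (𝔸(κ; Z) ↘ Z) ≫ z ≫ π := by
  rw [GaAction.subSweep, Category.assoc, sweep_comp hinv, GaAction.subgroupHom,
    AffineSpace.homOfVector_over_assoc]

end Sweep

section Orbit

open MvPolynomial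

variable {k : Type u} [Field k] {ι : Type u} [Fintype ι] {C S T : Scheme.{u}}
  {p : S ⟶ Spec (.of k)} {π : C ⟶ S} [IsAffineHom π] {G : ConeGrading π} {σ : GaAction ι (π ≫ p)}
  (hinv : σ.act ≫ π = (𝔸(ι; C) ↘ C) ≫ π) {V : S.affineOpens} {w : ℕ}
  (hsemi : IsSemidirect G σ w)
include hsemi

lemma evalAt_smul_of_mem (hw : 0 < w) (u : ι → Γ(T, ⊤)) (x : T ⟶ C) (h : ⊤ ≤ x ⁻¹ᵁ (π ⁻¹ᵁ V.1))
    (h' : ⊤ ≤ σ.smul u x ⁻¹ᵁ (π ⁻¹ᵁ V.1)) {f : Γ(C, π ⁻¹ᵁ V.1)} (hf : f ∈ G.piece V w) :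
    evalAt (σ.smul u x) h' f =
      evalAt x h f + ∑ l, u l * evalAt (x ≫ π) h (derivAtZero G hinv l f) := by
  rw [evalAt_smul hinv u x h]
  refine ((isGradedCoaction hinv G hsemi).eval₂_of_mem hw _ u hf).trans ?_
  simp only [← app_derivAtZero hinv hsemi _ hf, evalAt_app π x h h]

lemma smul_zeroSection_eq_self [CharZero k] (z : T ⟶ S) (h : ⊤ ≤ z ⁻¹ᵁ V.1) {ξ : ι → Γ(T, ⊤)}
    (hξ : ∀ g : Γ(C, π ⁻¹ᵁ V.1), ∑ l, ξ l * evalAt z h (derivAtZero G hinv l g) = 0) :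
    σ.smul ξ (z ≫ G.zeroSection) = z ≫ G.zeroSection := by
  have := isAddTorsionFree_of_scalar (z ≫ p)
  have hz := le_zeroSection_preimage G h
  refine eq_of_evalAt_eq (affine_preimage π V) (le_smul_preimage hinv _ hz) hz ?_
  rw [evalAt_smul hinv ξ _ hz]
  refine RingHom.ext fun g ↦ (isGradedCoaction hinv G hsemi).eval₂_eq_of_sum_vectorField_eq_zero
    _ (fun g ↦ ?_) g
  rw [evalAt_comp_zeroSection G z h]
  exact hξ g

omit hsemi in
lemma sum_lin_mul_evalAt {κ : Type u} [Fintype κ] (z : T ⟶ S) (h : ⊤ ≤ z ⁻¹ᵁ V.1)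
    (β : κ → ι → k) (c : κ → Γ(T, ⊤)) (g : Γ(C, π ⁻¹ᵁ V.1)) :
    ∑ l, GaAction.lin (z ≫ p) β c l * evalAt z h (derivAtZero G hinv l g) =
      ∑ j, c j * evalAt z h (derivAlong G hinv (β j) g) := by
  simp only [evalAt_derivAlong, GaAction.lin, Finset.sum_mul, Finset.mul_sum]
  rw [Finset.sum_comm]
  exact Finset.sum_congr rfl fun j _ ↦ Finset.sum_congr rfl fun l _ ↦ by ring

end Orbit

namespace IsDualFrame

variable {k : Type u} [Field k] {ι κ : Type u} [Fintype ι] [Fintype κ] [DecidableEq κ]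
  {C S T : Scheme.{u}} {p : S ⟶ Spec (.of k)} {π : C ⟶ S} [IsAffineHom π] {G : ConeGrading π}
  {σ : GaAction ι (π ≫ p)} {hinv : σ.act ≫ π = (𝔸(ι; C) ↘ C) ≫ π} {V : S.affineOpens} {w : ℕ}
  {β : κ → ι → k} {f : κ → Γ(C, π ⁻¹ᵁ V.1)} (hf : IsDualFrame G hinv w β f)
  (hsemi : IsSemidirect G σ w)
include hf hsemi

lemma evalAt_smul_lin (hw : 0 < w) (x : T ⟶ C) (h : ⊤ ≤ x ⁻¹ᵁ (π ⁻¹ᵁ V.1)) (c : κ → Γ(T, ⊤))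
    (h' : ⊤ ≤ σ.smul (GaAction.lin (x ≫ π ≫ p) β c) x ⁻¹ᵁ (π ⁻¹ᵁ V.1)) (j : κ) :
    evalAt (σ.smul (GaAction.lin (x ≫ π ≫ p) β c) x) h' (f j) = evalAt x h (f j) + c j := by
  rw [evalAt_smul_of_mem hinv hsemi hw _ x h _ (hf.mem j), ← Category.assoc,
    sum_lin_mul_evalAt hinv (x ≫ π) h]
  simp [hf.pairing, apply_ite]

lemma smul_zeroSection_eq_smul_lin [CharZero k] (z : T ⟶ S) (h : ⊤ ≤ z ⁻¹ᵁ V.1)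
    (u : ι → Γ(T, ⊤)) : σ.smul u (z ≫ G.zeroSection) =
      σ.smul (GaAction.lin (z ≫ p) β fun j ↦ ∑ l, u l * evalAt z h (derivAtZero G hinv l (f j)))
        (z ≫ G.zeroSection) := by
  set v := GaAction.lin (z ≫ p) β fun j ↦ ∑ l, u l * evalAt z h (derivAtZero G hinv l (f j))
  have hfix : σ.smul (u - v) (z ≫ G.zeroSection) = z ≫ G.zeroSection := by
    refine smul_zeroSection_eq_self hinv hsemi z h fun g ↦ ?_
    simp only [Pi.sub_apply, sub_mul, Finset.sum_sub_distrib]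
    rw [sum_lin_mul_evalAt hinv z h, sub_eq_zero]
    simp only [hf.relation _ g, map_sum, map_mul, Finset.mul_sum, Finset.sum_mul, mul_assoc]
    exact Finset.sum_comm
  rw [← add_sub_cancel v u, σ.add_smul, hfix]

lemma actsFreelyOn (hw : 0 < w) : σ.ActsFreelyOn β (π ⁻¹ᵁ V.1) := by
  intro T x hx c hc
  have hc0 : c = 0 := funext fun j ↦ by
    have hj := hf.evalAt_smul_lin hsemi hw x hx.ge c (le_smul_preimage hinv _ hx.ge) j
    simp only [hc, left_eq_add] at hj
    exact hj
  ext l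
  simp [hc0, GaAction.lin]

end IsDualFrame

/-! ### The sweeping morphisms over an affine open subset of the base -/

section MorphismRestrict

variable {X X' C : Scheme.{u}}

lemma exists_comp_morphismRestrict_eq {f : X ⟶ C} {f' : X' ⟶ C} {W : C.Opens}
    (g : (f ⁻¹ᵁ W).toScheme ⟶ X') (hg : g ≫ f' = (f ⁻¹ᵁ W).ι ≫ f) :
    ∃ g' : (f ⁻¹ᵁ W).toScheme ⟶ (f' ⁻¹ᵁ W).toScheme, g' ≫ f' ∣_ W = f ∣_ W := by
  refine ⟨IsOpenImmersion.lift (f' ⁻¹ᵁ W).ι g ?_, ?_⟩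
  · rw [Scheme.Opens.range_ι]
    rintro _ ⟨x, rfl⟩
    change f' (g x) ∈ W
    rw [← Scheme.Hom.comp_apply, hg]
    exact x.2
  · rw [← cancel_mono W.ι, Category.assoc, morphismRestrict_ι, morphismRestrict_ι,
      IsOpenImmersion.lift_fac_assoc, hg]

lemma isClosedImmersion_morphismRestrict {f : X ⟶ C} {W : C.Opens} [W.toScheme.IsSeparated]
    (ρ : W.toScheme ⟶ X) (hρ : ⊤ ≤ ρ ⁻¹ᵁ (f ⁻¹ᵁ W)) (h : f ∣_ W ≫ ρ = (f ⁻¹ᵁ W).ι) :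
    IsClosedImmersion (f ∣_ W) := by
  let r : W.toScheme ⟶ (f ⁻¹ᵁ W).toScheme := IsOpenImmersion.lift (f ⁻¹ᵁ W).ι ρ <| by
    rw [Scheme.Opens.range_ι]
    rintro _ ⟨x, rfl⟩
    exact hρ (Set.mem_univ x)
  have hr : f ∣_ W ≫ r = 𝟙 _ := by
    rw [← cancel_mono (f ⁻¹ᵁ W).ι, Category.assoc, IsOpenImmersion.lift_fac, h, Category.id_comp]
  have : IsClosedImmersion (f ∣_ W ≫ r) := by rw [hr]; infer_instance
  exact IsClosedImmersion.of_comp (f ∣_ W) r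

lemma range_subset_of_comp_eq {Y : Scheme.{u}} {g : X ⟶ Y} {f : Y ⟶ C} {f' : X ⟶ C}
    (h : g ≫ f = f') : Set.range f' ⊆ Set.range f := by
  rw [← h, Scheme.Hom.comp_base, TopCat.coe_comp]
  exact Set.range_comp_subset_range g f

lemma isClosed_range_of_morphismRestrict {f : X ⟶ C}
    (h : ∀ y : C, ∃ W : C.Opens, y ∈ W ∧ IsClosed (Set.range (f ∣_ W))) :
    IsClosed (Set.range f) := by
  choose W hyW hW using h
  have hcov : TopologicalSpace.IsOpenCover W :=
    eq_top_iff.2 fun y _ ↦ TopologicalSpace.Opens.mem_iSup.2 ⟨y, hyW y⟩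
  refine hcov.isClosed_iff_coe_preimage.2 fun y ↦ ?_
  have hy := hW y
  rw [morphismRestrict_base] at hy
  exact Set.range_restrictPreimage (W y : Set C) f ▸ hy

end MorphismRestrict

section Local

variable {k : Type u} [Field k] {ι κ : Type u} [Fintype κ] {C S T : Scheme.{u}}
  {p : S ⟶ Spec (.of k)} {π : C ⟶ S} [IsAffineHom π] {G : ConeGrading π} {σ : GaAction ι (π ≫ p)}

lemma exists_comp_sweep_eq_subSweep (β : κ → ι → k) (W : C.Opens) :
    ∃ g, g ≫ σ.sweep G.zeroSection ∣_ W = σ.subSweep β G.zeroSection ∣_ W :=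
  exists_comp_morphismRestrict_eq
    ((σ.subSweep β G.zeroSection ⁻¹ᵁ W).ι ≫ GaAction.subgroupHom (G.zeroSection ≫ π ≫ p) β)
    (by rw [GaAction.subSweep, Category.assoc])

namespace IsDualFrame

variable [Fintype ι] [DecidableEq κ] {hinv : σ.act ≫ π = (𝔸(ι; C) ↘ C) ≫ π} {V : S.affineOpens}
  {w : ℕ} {β : κ → ι → k} {f : κ → Γ(C, π ⁻¹ᵁ V.1)} (hf : IsDualFrame G hinv w β f)
  (hsemi : IsSemidirect G σ w)
include hf hsemi

lemma exists_comp_subSweep_eq_sweep [CharZero k] :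
    ∃ g, g ≫ σ.subSweep β G.zeroSection ∣_ (π ⁻¹ᵁ V.1) =
      σ.sweep G.zeroSection ∣_ (π ⁻¹ᵁ V.1) := by
  let y := (σ.sweep G.zeroSection ⁻¹ᵁ (π ⁻¹ᵁ V.1)).ι
  let z := y ≫ (𝔸(ι; S) ↘ S)
  have hz : ⊤ ≤ z ⁻¹ᵁ V.1 := by
    have hy : z = y ≫ σ.sweep G.zeroSection ≫ π := by
      rw [sweep_comp hinv, G.zeroSection_comp, Category.comp_id]
    rw [hy]
    exact (Scheme.Opens.ι_preimage_self _).ge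
  let u (l : ι) := y.appTop (AffineSpace.coord S l)
  refine exists_comp_morphismRestrict_eq (AffineSpace.homOfVector z
    fun j ↦ ∑ l, u l * evalAt z hz (derivAtZero G hinv l (f j))) ?_
  rw [GaAction.comp_subSweep, GaAction.comp_sweep]
  simp only [AffineSpace.homOfVector_over, AffineSpace.homOfVector_appTop_coord,
    reassoc_of% G.zeroSection_comp]
  exact (hf.smul_zeroSection_eq_smul_lin hsemi z hz u).symm

variable (hw : 0 < w)
include hw

lemma evalAt_comp_subSweep (y : T ⟶ 𝔸(κ; S))
    (h : ⊤ ≤ (y ≫ σ.subSweep β G.zeroSection) ⁻¹ᵁ (π ⁻¹ᵁ V.1)) (j : κ) :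
    evalAt (y ≫ σ.subSweep β G.zeroSection) h (f j) = y.appTop (AffineSpace.coord S j) := by
  let z := y ≫ (𝔸(κ; S) ↘ S)
  have hz : ⊤ ≤ z ⁻¹ᵁ V.1 := by
    have hy : z = y ≫ σ.subSweep β G.zeroSection ≫ π := by
      rw [subSweep_comp hinv, G.zeroSection_comp, Category.comp_id]
    rw [hy]
    exact h
  have hsweep : y ≫ σ.subSweep β G.zeroSection = σ.smul (GaAction.lin ((z ≫ G.zeroSection) ≫ π ≫ p)
      β fun j ↦ y.appTop (AffineSpace.coord S j)) (z ≫ G.zeroSection) := by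
    rw [GaAction.comp_subSweep, Category.assoc z]
  revert h
  rw [hsweep]
  intro h
  rw [hf.evalAt_smul_lin hsemi hw _ (le_zeroSection_preimage G hz), evalAt_comp_zeroSection G z hz,
    RingHom.comp_apply, G.zeroRing_of_mem V hw (hf.mem j), map_zero, zero_add]

/-- The dual functions restrict to the coordinates of `U'` on each orbit of the zero section, so
together with `π` they define a retraction of `(u, z) ↦ u.z`. -/
lemma isClosedImmersion_subSweep :
    IsClosedImmersion (σ.subSweep β G.zeroSection ∣_ (π ⁻¹ᵁ V.1)) := by
  let W := π ⁻¹ᵁ V.1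
  let φ := σ.subSweep β G.zeroSection
  have hφ : φ ≫ π = 𝔸(κ; S) ↘ S := by
    rw [subSweep_comp hinv, G.zeroSection_comp, Category.comp_id]
  have hW : ⊤ ≤ W.ι ⁻¹ᵁ W := W.ι_preimage_self.ge
  have : IsAffine W := affine_preimage π V
  let ρ : W.toScheme ⟶ 𝔸(κ; S) := AffineSpace.homOfVector (W.ι ≫ π) fun j ↦ evalAt W.ι hW (f j)
  have hι : φ ∣_ W ≫ W.ι = (φ ⁻¹ᵁ W).ι ≫ φ := morphismRestrict_ι φ W
  refine isClosedImmersion_morphismRestrict ρ ?_ (AffineSpace.hom_ext ?_ fun j ↦ ?_)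
  · have hρ : ρ ≫ φ ≫ π = W.ι ≫ π := by rw [hφ, AffineSpace.homOfVector_over]
    have := congr($hρ ⁻¹ᵁ V.1)
    exact hW.trans this.ge
  · rw [Category.assoc, AffineSpace.homOfVector_over, reassoc_of% hι, hφ]
  · rw [Scheme.Hom.comp_appTop, CommRingCat.comp_apply, AffineSpace.homOfVector_appTop_coord]
    have h : ⊤ ≤ ((φ ⁻¹ᵁ W).ι ≫ φ) ⁻¹ᵁ W := (φ ⁻¹ᵁ W).ι_preimage_self.ge
    rw [← hf.evalAt_comp_subSweep hsemi hw _ h]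
    have h' : ⊤ ≤ (φ ∣_ W ≫ W.ι) ⁻¹ᵁ W := hι ▸ h
    refine (congr($(evalAt_comp (φ ∣_ W) W.ι hW h') (f j))).symm.trans ?_
    congr 2

end IsDualFrame

end Local

end GradedAdditive

end

theorem lemma5p1_general {k : Type u} [Field k] [IsAlgClosed k] [CharZero k]
    {C S : Scheme.{u}} [IsReduced S] (p : S ⟶ Spec (.of k)) [LocallyOfFiniteType p] (π : C ⟶ S)
    [IsAffineHom π] (G : ConeGrading π) {ι : Type u} [Finite ι] {w d : ℕ} (hw : 0 < w)
    (σ : GaAction ι (π ≫ p)) (hinv : σ.act ≫ π = (𝔸(ι; C) ↘ C) ≫ π) (hsemi : IsSemidirect G σ w)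
    (hstab : ∀ z : Spec (.of k) ⟶ S, z ≫ p = 𝟙 _ →
      Module.finrank k (σ.stab (z ≫ G.zeroSection)) = d) :
    IsClosed (Set.range (σ.sweep G.zeroSection)) ∧
    ∀ s : S, ∃ V : S.affineOpens, s ∈ V.1 ∧
      ∃ (b : ℕ) (β : ULift.{u} (Fin b) → (ι → k)),
        LinearIndependent k β ∧
        (∀ z : Spec (.of k) ⟶ S, z ≫ p = 𝟙 _ → z ⁻¹ᵁ V.1 = ⊤ →
          IsCompl (Submodule.span k (Set.range β)) (σ.stab (z ≫ G.zeroSection))) ∧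
        σ.ActsFreelyOn β (π ⁻¹ᵁ V.1) ∧
        Set.range (σ.sweep G.zeroSection ∣_ (π ⁻¹ᵁ V.1)) =
          Set.range (σ.subSweep β G.zeroSection ∣_ (π ⁻¹ᵁ V.1)) ∧
        Set.range (σ.sweep G.zeroSection ∣_ (π ⁻¹ᵁ V.1)) =
          ((σ.subSweep β G.zeroSection ∣_ (π ⁻¹ᵁ V.1)).ker.support : Set _) ∧
        (σ.sweep G.zeroSection ∣_ (π ⁻¹ᵁ V.1)).ker =
          (σ.subSweep β G.zeroSection ∣_ (π ⁻¹ᵁ V.1)).ker := by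
  cases nonempty_fintype ι
  refine (and_iff_right_of_imp fun hlocal ↦ isClosed_range_of_morphismRestrict fun x ↦ ?_).2
    fun s ↦ ?_
  · obtain ⟨V, hV, b, β, -, -, -, -, hsupport, -⟩ := hlocal (π x)
    exact ⟨π ⁻¹ᵁ V.1, hV, hsupport ▸ TopologicalSpace.Closeds.isClosed _⟩
  · obtain ⟨V, hsV, b, β, f, hβ, hcompl, hf⟩ := exists_isDualFrame hinv hw hsemi hstab s
    obtain ⟨g, hg⟩ := hf.exists_comp_subSweep_eq_sweep hsemi
    obtain ⟨g', hg'⟩ := exists_comp_sweep_eq_subSweep (G := G) (σ := σ) β (π ⁻¹ᵁ V.1)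
    have := hf.isClosedImmersion_subSweep hsemi hw
    have hrange := (range_subset_of_comp_eq hg).antisymm (range_subset_of_comp_eq hg')
    refine ⟨V, hsV, b, β, hβ, hcompl, hf.actsFreelyOn hsemi hw, hrange, ?_, le_antisymm ?_ ?_⟩
    · rw [hrange, Scheme.Hom.support_ker,
        (Scheme.Hom.isClosedEmbedding _).isClosed_range.closure_eq]
    · rw [← hg']
      exact Scheme.Hom.le_ker_comp _ _
    · rw [← hg]
      exact Scheme.Hom.le_ker_comp _ _

theorem lemma5p1 {k : Type u} [Field k] [IsAlgClosed k] [CharZero k]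
    {C S : Scheme.{u}} (p : S ⟶ Spec (.of k)) (π : C ⟶ S) [IsAffineHom π]
    (hS : IsVariety p) (hC : IsVariety (π ≫ p)) (G : ConeGrading π)
    (r w : ℕ) (hr : 0 < r) (hw : 0 < w)
    (σ : GaAction (ULift.{u} (Fin r)) (π ≫ p))
    (hinv : σ.act ≫ π = (𝔸(ULift.{u} (Fin r); C) ↘ C) ≫ π)
    (hsemi : IsSemidirect G σ w)
    (hstab : ∀ z : Spec (.of k) ⟶ S, z ≫ p = 𝟙 _ →
      Module.finrank k (σ.stab (z ≫ G.zeroSection)) = minStabDim G σ) :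
    IsClosed (Set.range (σ.sweep G.zeroSection)) ∧
    ∀ s : S, ∃ V : S.affineOpens, s ∈ V.1 ∧
      ∃ (b : ℕ) (β : ULift.{u} (Fin b) → (ULift.{u} (Fin r) → k)),
        LinearIndependent k β ∧
        (∀ z : Spec (.of k) ⟶ S, z ≫ p = 𝟙 _ → z ⁻¹ᵁ V.1 = ⊤ →
          IsCompl (Submodule.span k (Set.range β)) (σ.stab (z ≫ G.zeroSection))) ∧
        σ.ActsFreelyOn β (π ⁻¹ᵁ V.1) ∧
        Set.range (σ.sweep G.zeroSection ∣_ (π ⁻¹ᵁ V.1)) =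
          Set.range (σ.subSweep β G.zeroSection ∣_ (π ⁻¹ᵁ V.1)) ∧
        Set.range (σ.sweep G.zeroSection ∣_ (π ⁻¹ᵁ V.1)) =
          ((σ.subSweep β G.zeroSection ∣_ (π ⁻¹ᵁ V.1)).ker.support : Set _) ∧
        (σ.sweep G.zeroSection ∣_ (π ⁻¹ᵁ V.1)).ker =
          (σ.subSweep β G.zeroSection ∣_ (π ⁻¹ᵁ V.1)).ker := by
  have := hS.isIntegral
  have := hS.locallyOfFiniteType
  exact lemma5p1_general p π G hw σ hinv hsemi hstab
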